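/- For a graph $G$ and $k\ge 1$ let $G^k$ be the graph on $V(G)$ in which two distinct vertices are adjacent iff their distance in $G$ is at most $k$; let $\chi$ denote the chromatic number and $\chi_\ell$ the list-chromatic number. All graphs in the conclusions are finite, and $\log$ is the natural logarithm. **Construction.** Let $k\ge 2$, and let $(\mathcal P,\mathcal L)$ be an affine plane with $n^2$ points (so of order $n$). Let $L_0,L_1$ be two different parallel classes of lines, and let $H$ be the point–line incidence graph with parts $\mathcal P$ and $\mathcal L\setminus L_0$. Replace every edge $p\ell$ of $H$ by a path from $p$ to $\ell$ with vertices $p=(p\ell)_0,(p\ell)_1,(p\ell)_2,\dots$, of length $k$ (so $(p\ell)_k=\ell$) if $\ell\in L_1$, and of length $k+1$ (so $(p\ell)_{k+1}=\ell$) if $\ell\notin L_1$. Then, for every line $\ell\notin L_0\cup L_1$, make the neighbourhood $\{(p\ell)_k : p\in\ell\}$ of $\ell$ a clique and delete $\ell$. Call the resulting graph $G$; the level of $(p\ell)_m$ is $m$. For a line $a\in L_0$, a parallel class $C\neq L_0$ and $0\le m\le k$ put $V_{a,C,m}=\{(p\ell)_m : p\in a\cap\ell,\ \ell\in C\}$.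 **Theorem 1.** (a) There is an absolute constant $c>0$ such that for every integer $k\ge 1$ there is an infinite family of pairwise non-isomorphic finite graphs $F$ with $\chi(F^k)$ unbounded on the family and $$\chi_\ell(F^k)\ \ge\ c\,\chi(F^k)\,\log\chi(F^k)$$ for every member $F$. For every $k\ge 2$ such graphs are obtained as $F=G^4$: for every $M$ there is an $N$ such that, for every affine plane of order $n\ge N$ and every choice of $L_0\ne L_1$, the graph $F=G^4$ satisfies $\chi(F^k)\ge M$ and the displayed inequality with the same $c$. (b) For every $k\ge1$ there is a finite graph $F$ with $\chi_\ell(F^k)\ne\chi(F^k)$; that is, for no $k\ge 1$ are all $k$-th powers chromatic-choosable. (c) An affine plane with $q^2$ points exists for every prime power $q$. (d) For every $k\ge2$, every affine plane with $n^2$ points and all $L_0\neq L_1$ as above: the different sets among the $V_{a,C,m}$ form a partition of $V(G)$ into $kn^2+1$ sets of size $n$, and each of them is independent in $G^{4k}$, so $G^{4k}$ is multipartite with this partition. The vertices of levels $0,\dots,k-1$ are the union of $(k-1)n^2+n$ of these sets (those with $m<k$), and the subgraph of $G^{4k}$ they induce is complete multipartite with these $(k-1)n^2+n$ sets, each of size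 $n$, as its parts. -/

import Mathlib

universe u

namespace PowerChoosability

/-! ### Graph powers and list colouring -/

/-- The `k`-th power of `G`: distinct vertices are adjacent iff their distance in `G` is at most
`k` (`edist` is the extended distance, infinite between different components). -/
def power {V : Type u} (G : SimpleGraph V) (k : ℕ) : SimpleGraph V where
  Adj x y := x ≠ y ∧ G.edist x y ≤ (k : ℕ∞)
  symm := ⟨fun x y h => ⟨h.1.symm, by rw [SimpleGraph.edist_comm]; exact h.2⟩⟩
  loopless := ⟨fun _ h => h.1 rfl⟩

/-- `G` is `m`-choosable: for every assignment `L` of lists of exactly `m` colours to the vertices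
there is a proper colouring in which each vertex receives a colour of its list. -/
def Choosable {V : Type u} (G : SimpleGraph V) (m : ℕ) : Prop :=
  ∀ (α : Type u) (L : V → Finset α), (∀ v, (L v).card = m) →
    ∃ f : G.Coloring α, ∀ v, f v ∈ L v

/-- The list-chromatic number: the least `m` such that `G` is `m`-choosable (`⊤` if none). -/
noncomputable def listChromaticNumber {V : Type u} (G : SimpleGraph V) : ℕ∞ :=
  ⨅ m ∈ {m : ℕ | Choosable G m}, (m : ℕ∞)

/-- The chromatic and the list-chromatic number of `G` are finite, and `χ_ℓ ≥ c · χ · log χ`. -/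
def ListGap {V : Type u} (c : ℝ) (G : SimpleGraph V) : Prop :=
  ∃ x y : ℕ, G.chromaticNumber = (x : ℕ∞) ∧ listChromaticNumber G = (y : ℕ∞) ∧
    c * (x : ℝ) * Real.log (x : ℝ) ≤ (y : ℝ)

/-! ### Affine planes -/

/-- An affine plane with point set `P`; lines are sets of points. -/
structure AffinePlane (P : Type u) where
  /-- the set of lines -/
  lines : Set (Set P)
  /-- every line has at least two points -/
  two_points : ∀ l ∈ lines, l.Nontrivial
  /-- two distinct points lie on exactly one common line -/
  join : ∀ p q : P, p ≠ q → ∃! l : Set P, l ∈ lines ∧ p ∈ l ∧ q ∈ l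
  /-- through a point off a line there is exactly one line that does not meet it -/
  playfair : ∀ l ∈ lines, ∀ p : P, p ∉ l → ∃! m : Set P, m ∈ lines ∧ p ∈ m ∧ Disjoint m l
  /-- there are three non-collinear points -/
  triangle : ∃ p q r : P, ∀ l ∈ lines, ¬ (p ∈ l ∧ q ∈ l ∧ r ∈ l)

namespace AffinePlane

variable {P : Type u}

/-- The set of parallel classes of lines (two lines are parallel if equal or disjoint). -/
def classes (A : AffinePlane P) : Set (Set (Set P)) :=
  {C | ∃ l ∈ A.lines, C = {m | m ∈ A.lines ∧ (m = l ∨ Disjoint m l)}}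

/-! ### The graph `G`

Fix an affine plane `A`, two sets of lines `C₀`, `C₁` (in use: two different parallel classes, the
classes `L₀` and `L₁`) and `k`. -/

/-- An edge `pℓ` of the point-line incidence graph `H`, whose lines are those outside `C₀`. -/
structure Edge (A : AffinePlane P) (C₀ : Set (Set P)) where
  /-- the point `p` -/
  pt : P
  /-- the line `ℓ` -/
  line : Set P
  line_mem : line ∈ A.lines
  line_notMem : line ∉ C₀
  incident : pt ∈ line

/-- The vertices of `G`: the points of the plane, the lines in `C₁`, and the vertices `(pℓ)_m`
created by the subdivision: `1 ≤ m ≤ k - 1` if `ℓ ∈ C₁` (the edge `pℓ` becomes a path of length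
`k`), and `1 ≤ m ≤ k` otherwise (it becomes a path of length `k + 1`). The lines outside `C₁` are
deleted in `G`. -/
inductive Vertex (A : AffinePlane P) (C₀ C₁ : Set (Set P)) (k : ℕ) : Type u
  | point (p : P) : Vertex A C₀ C₁ k
  | inner (e : A.Edge C₀) (m : ℕ) (h : 1 ≤ m ∧ (m < k ∨ (m = k ∧ e.line ∉ C₁))) :
      Vertex A C₀ C₁ k
  | line (l : Set P) (h : l ∈ C₁) : Vertex A C₀ C₁ k

/-- The level of a vertex. -/
def Vertex.level {A : AffinePlane P} {C₀ C₁ : Set (Set P)} {k : ℕ} : Vertex A C₀ C₁ k → ℕ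
  | .point _ => 0
  | .inner _ m _ => m
  | .line _ _ => k

open Classical in
/-- The vertex `(pℓ)_m` for `0 ≤ m ≤ k`: `(pℓ)_0 = p`, and `(pℓ)_k = ℓ` if `ℓ ∈ C₁`. -/
noncomputable def node (A : AffinePlane P) (C₀ C₁ : Set (Set P)) (k : ℕ) (e : A.Edge C₀)
    (m : Fin (k + 1)) : Vertex A C₀ C₁ k :=
  if h0 : (m : ℕ) = 0 then .point e.pt
  else if h1 : (m : ℕ) = k ∧ e.line ∈ C₁ then .line e.line h1.2
  else .inner e m (by
    refine ⟨Nat.one_le_iff_ne_zero.mpr h0, ?_⟩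
    by_cases hk : (m : ℕ) = k
    · exact Or.inr ⟨hk, fun hm => h1 ⟨hk, hm⟩⟩
    · exact Or.inl (lt_of_le_of_ne (Nat.lt_succ_iff.mp m.isLt) hk))

/-- The graph `G`: consecutive vertices of the subdivision paths are adjacent, and for every line
`ℓ` outside `C₀ ∪ C₁` the vertices `(pℓ)_k`, `p ∈ ℓ`, which are the neighbours of the deleted
vertex `ℓ`, form a clique (`fromRel` symmetrizes and removes loops). -/
noncomputable def graph (A : AffinePlane P) (C₀ C₁ : Set (Set P)) (k : ℕ) :
    SimpleGraph (Vertex A C₀ C₁ k) :=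
  SimpleGraph.fromRel fun u v =>
    (∃ (e : A.Edge C₀) (i : Fin k), u = A.node C₀ C₁ k e i.castSucc ∧
      v = A.node C₀ C₁ k e i.succ) ∨
    (∃ e f : A.Edge C₀, e.line = f.line ∧ e.line ∉ C₁ ∧
      u = A.node C₀ C₁ k e (Fin.last k) ∧ v = A.node C₀ C₁ k f (Fin.last k))

/-- The set of the vertices `(pℓ)_m` with `p` on the line `a` (of `C₀`) and `ℓ` in the parallel
class `C`. -/
def part (A : AffinePlane P) (C₀ C₁ : Set (Set P)) (k : ℕ) (a : Set P) (C : Set (Set P))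
    (m : Fin (k + 1)) : Set (Vertex A C₀ C₁ k) :=
  {v | ∃ e : A.Edge C₀, e.pt ∈ a ∧ e.line ∈ C ∧ v = A.node C₀ C₁ k e m}

/-- The family of all parts of the vertex set of `G`. -/
def parts (A : AffinePlane P) (C₀ C₁ : Set (Set P)) (k : ℕ) : Set (Set (Vertex A C₀ C₁ k)) :=
  {S | ∃ a ∈ C₀, ∃ C ∈ A.classes, C ≠ C₀ ∧ ∃ m : Fin (k + 1), S = A.part C₀ C₁ k a C m}

/-- The family of the parts at the levels `0, …, k - 1`. -/
def lowParts (A : AffinePlane P) (C₀ C₁ : Set (Set P)) (k : ℕ) :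
    Set (Set (Vertex A C₀ C₁ k)) :=
  {S | ∃ a ∈ C₀, ∃ C ∈ A.classes, C ≠ C₀ ∧ ∃ m : Fin (k + 1), (m : ℕ) < k ∧
    S = A.part C₀ C₁ k a C m}

end AffinePlane

end PowerChoosability

namespace PowerChoosability

/-! ### Powers of graphs -/

/-! The construction is tuned so that $G^{4k}$ lies between two multipartite graphs with parts of
size $n$: it has a proper colouring with $kn^2+1$ classes, and it contains a complete multipartite
graph with $r=(k-1)n^2+n$ parts. For $k\ge 2$ these numbers agree up to a factor 2, so $\chi$ has
the order of $r$. Since $(G^4)^k=G^{4k}$ (`power_power`), the graph $G^4$ serves for the exponent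
$k$. The exponent 1 is served by a square obtained for the exponent 2.

Distances become transparent after doubling: an edge $p\ell$ has weight $2k$ if $\ell\in C_1$ and
$2k+1$ otherwise. The points of two vertices in one part lie on a line of $C_0$, which is absent
from $G$, and their lines are parallel. A connecting route must therefore turn at another point, and
of the two nonparallel lines used there at most one is in $C_1$. This keeps the doubled distance
above $8k$; `four_mul_lt_edist` certifies it by a potential. Below level $k$, vertices of different
parts do have a route of length at most $4k$ (`edist_le_four_mul`), because a line in $C_1$ can be
combined with one outside it.

The list-chromatic number is bounded below by a probabilistic argument
(`not_choosable_of_multipartite`). From a palette of $rt$ colours take $n$ lists of about half its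
size such that every set of at most $t$ colours misses one of them, and use the same $n$ lists on
every part. Different parts use disjoint colour sets, so some part uses at most $t$ colours, and a
vertex of that part has a list avoiding all of them. The union bound permits
$t=\lfloor\log_{16}n\rfloor$, so $\chi_\ell$ exceeds a constant times $r\log n$, which is of the
order of $\chi\log\chi$ once $n\ge k$. -/

theorem edist_le_trans {V : Type u} {G : SimpleGraph V} {u v w : V} {a b : ℕ}
    (h₁ : G.edist u v ≤ (a : ℕ∞)) (h₂ : G.edist v w ≤ (b : ℕ∞)) :
    G.edist u w ≤ ((a + b : ℕ) : ℕ∞) := by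
  push_cast
  exact SimpleGraph.edist_triangle.trans (add_le_add h₁ h₂)

theorem edist_le_mono {V : Type u} {G : SimpleGraph V} {u v : V} {a b : ℕ}
    (h : G.edist u v ≤ (a : ℕ∞)) (hab : a ≤ b) : G.edist u v ≤ (b : ℕ∞) :=
  h.trans (by exact_mod_cast hab)

theorem exists_walk_of_edist_le {V : Type u} {G : SimpleGraph V} {u v : V} {a : ℕ}
    (h : G.edist u v ≤ (a : ℕ∞)) : ∃ w : G.Walk u v, w.length ≤ a := by
  obtain ⟨w, hw⟩ := SimpleGraph.exists_walk_of_edist_ne_top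
    (ne_top_of_le_ne_top (ENat.natCast_ne_top a) h)
  exact ⟨w, by rw [← hw] at h; exact_mod_cast h⟩

theorem edist_le_of_power {V : Type u} {G : SimpleGraph V} {a : ℕ} {u v : V}
    (w : (power G a).Walk u v) : G.edist u v ≤ ((a * w.length : ℕ) : ℕ∞) := by
  induction w with
  | nil => simp
  | cons h p ih =>
    refine edist_le_mono (edist_le_trans h.2 ih) ?_
    simp [Nat.mul_add, add_comm]

/-- The walk is cut into pieces of length at most `a`, each of which is a single step, or no step,
in the power. -/
theorem power_edist_le {V : Type u} {G : SimpleGraph V} {a : ℕ} (b : ℕ) :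
    ∀ {u v : V} (w : G.Walk u v), w.length ≤ a * b → (power G a).edist u v ≤ (b : ℕ∞) := by
  induction b with
  | zero =>
    intro u v w hw
    have : u = v := SimpleGraph.Walk.eq_of_length_eq_zero (p := w) (by omega)
    simp [this]
  | succ b ih =>
    intro u v w hw
    have h₁ : (power G a).edist u (w.getVert a) ≤ ((1 : ℕ) : ℕ∞) := by
      rw [Nat.cast_one, SimpleGraph.edist_le_one_iff_adj_or_eq]
      by_cases h : u = w.getVert a
      · exact Or.inr h
      · refine Or.inl ⟨h, (SimpleGraph.edist_le (w.take a)).trans ?_⟩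
        have : (w.take a).length ≤ a := by simp
        exact_mod_cast this
    have h₂ := ih (w.drop a) (by rw [SimpleGraph.Walk.drop_length]; rw [mul_add] at hw; omega)
    exact edist_le_mono (edist_le_trans h₁ h₂) (by omega)

/-- Powers of powers are powers. -/
theorem power_power {V : Type u} (G : SimpleGraph V) (a b : ℕ) :
    power (power G a) b = power G (a * b) := by
  ext u v
  refine and_congr_right fun _ => ⟨fun h => ?_, fun h => ?_⟩
  · obtain ⟨w, hw⟩ := exists_walk_of_edist_le h
    exact edist_le_mono (edist_le_of_power w) (Nat.mul_le_mul_left a hw)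
  · obtain ⟨w, hw⟩ := exists_walk_of_edist_le h
    exact power_edist_le b w hw

theorem power_one {V : Type u} (G : SimpleGraph V) : power G 1 = G := by
  ext u v
  change u ≠ v ∧ G.edist u v ≤ ((1 : ℕ) : ℕ∞) ↔ _
  rw [Nat.cast_one, SimpleGraph.edist_le_one_iff_adj_or_eq]
  exact ⟨fun h => h.2.resolve_right h.1, fun h => ⟨h.ne, Or.inl h⟩⟩

/-- An isomorphism of graphs is an isomorphism of their powers. -/
def powerIso {V W : Type u} {G : SimpleGraph V} {H : SimpleGraph W} (e : G ≃g H) (k : ℕ) :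
    power G k ≃g power H k where
  toEquiv := e.toEquiv
  map_rel_iff' := by
    have key : ∀ {V W : Type u} {G : SimpleGraph V} {H : SimpleGraph W} (e : G ≃g H) (u v : V),
        H.edist (e u) (e v) ≤ G.edist u v := by
      intro V W G H e u v
      by_cases h : G.edist u v = ⊤
      · rw [h]; exact le_top
      · obtain ⟨w, hw⟩ := SimpleGraph.exists_walk_of_edist_ne_top h
        rw [← hw, ← SimpleGraph.Walk.length_map e.toHom w]
        exact SimpleGraph.edist_le _
    intro u v
    have h : H.edist (e u) (e v) = G.edist u v := by
      refine le_antisymm (key e u v) ?_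
      have := key e.symm (e u) (e v)
      simpa using this
    change (e u ≠ e v ∧ H.edist (e u) (e v) ≤ _) ↔ (u ≠ v ∧ G.edist u v ≤ _)
    rw [h, e.injective.ne_iff]

/-! ### Choosability -/

theorem Choosable.mono {V : Type u} {G : SimpleGraph V} {a b : ℕ} (h : Choosable G a)
    (hab : a ≤ b) : Choosable G b := by
  intro α L hL
  choose L' hsub hcard using fun v => Finset.exists_subset_card_eq (hab.trans (hL v).ge)
  obtain ⟨f, hf⟩ := h α L' hcard
  exact ⟨f, fun v => hsub v (hf v)⟩

/-- Lists as large as the vertex set satisfy Hall's condition, so the vertices can even receive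
distinct colours. This makes the list-chromatic number of a finite graph finite. -/
theorem choosable_card {V : Type u} [Fintype V] (G : SimpleGraph V) :
    Choosable G (Fintype.card V) := by
  classical
  intro α L hL
  have hall : ∀ s : Finset V, s.card ≤ (s.biUnion L).card := by
    intro s
    obtain rfl | ⟨v, hv⟩ := s.eq_empty_or_nonempty
    · simp
    · exact (Finset.card_le_univ s).trans
        ((hL v).ge.trans (Finset.card_le_card (Finset.subset_biUnion_of_mem L hv)))
  obtain ⟨f, hf, hfL⟩ := (Finset.all_card_le_biUnion_card_iff_exists_injective L).1 hall
  exact ⟨SimpleGraph.Coloring.mk f fun h => hf.ne h.ne, hfL⟩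

theorem exists_listChromaticNumber {V : Type u} [Finite V] (G : SimpleGraph V) {d : ℕ}
    (h : ¬ Choosable G d) : ∃ y : ℕ, listChromaticNumber G = (y : ℕ∞) ∧ d < y := by
  have := Fintype.ofFinite V
  have htop : listChromaticNumber G ≤ (Fintype.card V : ℕ∞) :=
    iInf₂_le (Fintype.card V) (choosable_card G)
  obtain ⟨y, hy⟩ := ENat.ne_top_iff_exists.1 (ne_top_of_le_ne_top (ENat.natCast_ne_top _) htop)
  refine ⟨y, hy.symm, ?_⟩
  have : ((d + 1 : ℕ) : ℕ∞) ≤ listChromaticNumber G := by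
    refine le_iInf₂ fun m hm => ?_
    have : d < m := by
      by_contra hlt
      exact h (Choosable.mono hm (not_lt.1 hlt))
    exact_mod_cast this
  rw [← hy] at this
  exact_mod_cast this

/-- Most sets of size `d` in a set of size at least `2 d` avoid a given small set. -/
theorem choose_le_four_pow_mul_choose {s d : ℕ} (hd : 2 * d ≤ s) :
    ∀ t : ℕ, 3 * t ≤ s → s.choose d ≤ 4 ^ t * (s - t).choose d
  | 0, _ => by simp
  | t + 1, ht => by
    have ih := choose_le_four_pow_mul_choose hd t (by omega)
    obtain ⟨m, hm⟩ : ∃ m, s - t = m + 1 := ⟨s - t - 1, by omega⟩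
    have hm' : s - (t + 1) = m := by omega
    rw [hm] at ih
    rw [hm']
    have h := Nat.choose_mul_succ_eq m d
    -- Removing one element from the ground set costs the factor $(m+1)/(m+1-d)$, which is at most 4
    -- because $4d\le 2s\le 3(m+1)$.
    have h4 : m + 1 ≤ 4 * (m + 1 - d) := by omega
    have : (m + 1).choose d ≤ 4 * m.choose d := by
      have hpos : 0 < m + 1 - d := by omega
      refine Nat.le_of_mul_le_mul_right ?_ hpos
      rw [← h]
      calc m.choose d * (m + 1) ≤ m.choose d * (4 * (m + 1 - d)) := Nat.mul_le_mul_left _ h4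
        _ = _ := by ring
    calc s.choose d ≤ 4 ^ t * (m + 1).choose d := ih
      _ ≤ 4 ^ t * (4 * m.choose d) := Nat.mul_le_mul_left _ this
      _ = _ := by ring

/-- If every `b` is related to a proportion at least `p` of the elements of `A`, then some `n`
elements of `A` suffice to relate every `b` to one of them. -/
theorem exists_family_hitting {α β : Type*} (A : Finset α) (hA : A.Nonempty) (B : Finset β)
    (R : α → β → Prop) [∀ b, DecidablePred fun a => R a b] (p : ℝ)
    (hp : ∀ b ∈ B, p * (A.card : ℝ) ≤ ((A.filter fun a => R a b).card : ℝ)) (n : ℕ)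
    (hn : (B.card : ℝ) * (1 - p) ^ n < 1) :
    ∃ g : Fin n → α, (∀ i, g i ∈ A) ∧ ∀ b ∈ B, ∃ i, R (g i) b := by
  classical
  have hA0 : (0 : ℝ) < A.card := by exact_mod_cast hA.card_pos
  let X : Finset (Fin n → α) := Fintype.piFinset fun _ => A
  -- The bad tuples, those missing some `b`; the union bound shows that they do not exhaust all
  -- tuples.
  let Y : Finset (Fin n → α) :=
    B.biUnion fun b => Fintype.piFinset fun _ => A.filter fun a => ¬ R a b
  have hlt : Y.card < X.card := by
    have h₁ : (Y.card : ℝ) ≤ ∑ b ∈ B, ((1 - p) * (A.card : ℝ)) ^ n := by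
      calc (Y.card : ℝ) ≤ ((∑ b ∈ B, (Fintype.piFinset fun _ : Fin n =>
            A.filter fun a => ¬ R a b).card : ℕ) : ℝ) := by exact_mod_cast Finset.card_biUnion_le
        _ = ∑ b ∈ B, ((A.filter fun a => ¬ R a b).card : ℝ) ^ n := by
            push_cast
            refine Finset.sum_congr rfl fun b _ => ?_
            rw [Fintype.card_piFinset_const]; push_cast; rfl
        _ ≤ _ := by
            refine Finset.sum_le_sum fun b hb => ?_
            refine pow_le_pow_left₀ (Nat.cast_nonneg _) ?_ n
            have h := Finset.card_filter_add_card_filter_not (s := A) (fun a => R a b)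
            have h' : ((A.filter fun a => R a b).card : ℝ) +
              ((A.filter fun a => ¬ R a b).card : ℝ) = A.card := by exact_mod_cast h
            linarith [hp b hb]
    have h₂ : (X.card : ℝ) = (A.card : ℝ) ^ n := by
      simp only [X]; rw [Fintype.card_piFinset_const]; push_cast; rfl
    have : (Y.card : ℝ) < X.card := by
      rw [h₂]
      refine h₁.trans_lt ?_
      rw [Finset.sum_const, nsmul_eq_mul, mul_pow, ← mul_assoc]
      have := mul_lt_mul_of_pos_right hn (pow_pos hA0 n)
      linarith
    exact_mod_cast this
  obtain ⟨g, hgX, hgY⟩ := Finset.exists_mem_notMem_of_card_lt_card hlt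
  have hgA : ∀ i, g i ∈ A := Fintype.mem_piFinset.1 hgX
  refine ⟨g, hgA, fun b hb => ?_⟩
  by_contra hcon
  push Not at hcon
  exact hgY (Finset.mem_biUnion.2 ⟨b, hb, Fintype.mem_piFinset.2 fun i =>
    Finset.mem_filter.2 ⟨hgA i, hcon i⟩⟩)

/-- A list of `n` sets of size `d` in a set of size `s` such that every set of size `t` is disjoint
from one of them. -/
theorem exists_sets_avoiding {s d t n : ℕ} (hd : 2 * d ≤ s) (ht : 3 * t ≤ s)
    (hn : (s.choose t : ℝ) * (1 - ((4 : ℝ) ^ t)⁻¹) ^ n < 1) :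
    ∃ g : Fin n → Finset (Fin s), (∀ i, (g i).card = d) ∧
      ∀ T : Finset (Fin s), T.card ≤ t → ∃ i, Disjoint (g i) T := by
  classical
  obtain ⟨g, hg, hgT⟩ := exists_family_hitting
    (Finset.powersetCard d (Finset.univ : Finset (Fin s)))
    (Finset.powersetCard_nonempty.2 (by simp; omega))
    (Finset.powersetCard t (Finset.univ : Finset (Fin s))) (fun A T => Disjoint A T)
    ((4 : ℝ) ^ t)⁻¹ (by
      intro T hT
      have hT' : T.card = t := (Finset.mem_powersetCard.1 hT).2
      have : (Finset.powersetCard d (Finset.univ : Finset (Fin s))).filter (fun A => Disjoint A T)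
          = Finset.powersetCard d Tᶜ := by
        ext A
        simp [Finset.mem_powersetCard, Finset.subset_compl_iff_disjoint_right, and_comm]
      rw [this, Finset.card_powersetCard, Finset.card_powersetCard, Finset.card_compl, hT',
        Finset.card_univ, Fintype.card_fin, inv_mul_le_iff₀ (by positivity)]
      exact_mod_cast choose_le_four_pow_mul_choose hd t ht) n (by simpa using hn)
  refine ⟨g, fun i => (Finset.mem_powersetCard.1 (hg i)).2, fun T hT => ?_⟩
  -- The union bound ran over sets of size exactly `t`; smaller sets are enlarged first.
  obtain ⟨T', hsub, hT'⟩ := Finset.exists_superset_card_eq hT (by simp; omega)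
  obtain ⟨i, hi⟩ := hgT T' (Finset.mem_powersetCard.2 ⟨Finset.subset_univ _, hT'⟩)
  exact ⟨i, hi.mono_right hsub⟩

/-- A lower bound for the choice number of a graph that contains a complete multipartite graph with
`r` parts of size `n`. -/
theorem not_choosable_of_multipartite {V : Type} (G : SimpleGraph V) {r n t : ℕ}
    (ι : Fin r × Fin n → V) (hι : Function.Injective ι)
    (hadj : ∀ i j x y, i ≠ j → G.Adj (ι (i, x)) (ι (j, y))) (hr : 3 ≤ r)
    (hn : ((r * t).choose t : ℝ) * (1 - ((4 : ℝ) ^ t)⁻¹) ^ n < 1) :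
    ¬ Choosable G (r * t / 2) := by
  classical
  intro hch
  obtain ⟨g, hgcard, hg⟩ := exists_sets_avoiding (s := r * t) (d := r * t / 2) (t := t) (n := n)
    (by omega) (Nat.mul_le_mul_right t hr) hn
  obtain ⟨D, -, hD⟩ := Finset.exists_subset_card_eq
    (s := (Finset.univ : Finset (Fin (r * t)))) (n := r * t / 2) (by simp; omega)
  -- The list of a vertex depends only on its position `x` inside its part. Vertices outside the
  -- multipartite subgraph get the dummy list `D`, since `Choosable` asks for lists of one exact
  -- size.
  obtain ⟨f, hf⟩ := hch (Fin (r * t)) (Function.extend ι (fun z => g z.2) fun _ => D) (by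
    intro v
    by_cases hv : ∃ z, ι z = v
    · obtain ⟨z, rfl⟩ := hv
      rw [hι.extend_apply]; exact hgcard _
    · rw [Function.extend_apply' _ _ _ hv]; exact hD)
  have hf' : ∀ i x, f (ι (i, x)) ∈ g x := fun i x => by
    have := hf (ι (i, x)); rwa [hι.extend_apply] at this
  let T : Fin r → Finset (Fin (r * t)) := fun i => Finset.univ.image fun x => f (ι (i, x))
  have hdisj : ∀ i ∈ (Finset.univ : Finset (Fin r)), ∀ j ∈ (Finset.univ : Finset (Fin r)),
      i ≠ j → Disjoint (T i) (T j) := by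
    intro i _ j _ hij
    rw [Finset.disjoint_left]
    intro c hi hj
    obtain ⟨x, -, rfl⟩ := Finset.mem_image.1 hi
    obtain ⟨y, -, hy⟩ := Finset.mem_image.1 hj
    exact f.valid (hadj i j x y hij) hy.symm
  -- The colour sets of the `r` parts are disjoint in a palette of `r * t` colours, so one of them
  -- has at most `t` colours.
  have hsum : ∑ i, (T i).card ≤ ∑ _i : Fin r, t := by
    rw [← Finset.card_biUnion hdisj]
    refine (Finset.card_le_univ _).trans ?_
    simp
  obtain ⟨i, -, hi⟩ := Finset.exists_le_of_sum_le
    (Finset.univ_nonempty_iff.2 ⟨(⟨0, by omega⟩ : Fin r)⟩) hsum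
  obtain ⟨x, hx⟩ := hg (T i) hi
  exact Finset.disjoint_left.1 hx (hf' i x) (Finset.mem_image_of_mem _ (Finset.mem_univ x))

end PowerChoosability

/-! ### Affine planes: parallelism, cardinalities and coordinate planes. -/

namespace PowerChoosability
namespace AffinePlane

variable {P : Type u} {A : AffinePlane P} {C D C₀ C₁ : Set (Set P)} {l m : Set P} {p q : P} {n : ℕ}

/-! ### Parallel classes -/

theorem line_eq (hl : l ∈ A.lines) (hm : m ∈ A.lines) (hpq : p ≠ q) (hpl : p ∈ l) (hql : q ∈ l)
    (hpm : p ∈ m) (hqm : q ∈ m) : l = m :=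
  (A.join p q hpq).unique ⟨hl, hpl, hql⟩ ⟨hm, hpm, hqm⟩

/-- If the two lines share a point off `l`, both are the unique parallel to `l` through that point.
-/
theorem parallel_trans {l m₁ m₂ : Set P} (hl : l ∈ A.lines) (h₁ : m₁ ∈ A.lines)
    (h₂ : m₂ ∈ A.lines) (p₁ : m₁ = l ∨ Disjoint m₁ l) (p₂ : m₂ = l ∨ Disjoint m₂ l) :
    m₁ = m₂ ∨ Disjoint m₁ m₂ := by
  by_cases hd : Disjoint m₁ m₂
  · exact Or.inr hd
  · obtain ⟨p, hp₁, hp₂⟩ := Set.not_disjoint_iff.1 hd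
    left
    rcases p₁ with rfl | d₁
    · rcases p₂ with rfl | d₂
      · rfl
      · exact absurd d₂.symm hd
    · rcases p₂ with rfl | d₂
      · exact absurd d₁ hd
      · exact (A.playfair l hl p (fun h => Set.disjoint_left.1 d₁ hp₁ h)).unique
          ⟨h₁, hp₁, d₁⟩ ⟨h₂, hp₂, d₂⟩

theorem mem_lines_of_mem (hC : C ∈ A.classes) (hl : l ∈ C) : l ∈ A.lines := by
  obtain ⟨l₀, -, rfl⟩ := hC
  exact hl.1

theorem eq_or_disjoint (hC : C ∈ A.classes) (hl : l ∈ C) (hm : m ∈ C) :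
    l = m ∨ Disjoint l m := by
  obtain ⟨l₀, h₀, rfl⟩ := hC
  exact parallel_trans h₀ hl.1 hm.1 hl.2 hm.2

theorem eq_of_mem (hC : C ∈ A.classes) (hl : l ∈ C) (hm : m ∈ C) (hpl : p ∈ l) (hpm : p ∈ m) :
    l = m :=
  (eq_or_disjoint hC hl hm).resolve_right fun h => Set.disjoint_left.1 h hpl hpm

/-- The parallel class of a line. -/
def classOf (A : AffinePlane P) (l : Set P) : Set (Set P) :=
  {m | m ∈ A.lines ∧ (m = l ∨ Disjoint m l)}

theorem classOf_mem (hl : l ∈ A.lines) : A.classOf l ∈ A.classes := ⟨l, hl, rfl⟩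

theorem mem_classOf (hl : l ∈ A.lines) : l ∈ A.classOf l := ⟨hl, Or.inl rfl⟩

theorem eq_classOf (hC : C ∈ A.classes) (hl : l ∈ C) : C = A.classOf l := by
  obtain ⟨l₀, h₀, rfl⟩ := hC
  ext m
  constructor
  · intro hm
    exact ⟨hm.1, parallel_trans h₀ hm.1 hl.1 hm.2 hl.2⟩
  · intro hm
    have hll : l₀ = l ∨ Disjoint l₀ l := hl.2.imp Eq.symm fun h => h.symm
    exact ⟨hm.1, parallel_trans hl.1 hm.1 h₀ hm.2 hll⟩

theorem class_eq (hC : C ∈ A.classes) (hD : D ∈ A.classes) (hl : l ∈ C) (hm : l ∈ D) : C = D :=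
  (eq_classOf hC hl).trans (eq_classOf hD hm).symm

theorem notMem_of_ne (hC : C ∈ A.classes) (hD : D ∈ A.classes) (hCD : C ≠ D) (hl : l ∈ C) :
    l ∉ D := fun h => hCD (class_eq hC hD hl h)

theorem class_nonempty (hC : C ∈ A.classes) : C.Nonempty := by
  obtain ⟨l₀, h₀, rfl⟩ := hC
  exact ⟨l₀, mem_classOf h₀⟩

theorem line_nonempty (hl : l ∈ A.lines) : l.Nonempty := (A.two_points l hl).nonempty

theorem exists_line_through (hC : C ∈ A.classes) (p : P) : ∃ l ∈ C, p ∈ l := by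
  obtain ⟨l₀, h₀, rfl⟩ := hC
  by_cases hp : p ∈ l₀
  · exact ⟨l₀, mem_classOf h₀, hp⟩
  · obtain ⟨m, ⟨hm, hpm, hd⟩, -⟩ := A.playfair l₀ h₀ p hp
    exact ⟨m, ⟨hm, Or.inr hd⟩, hpm⟩

/-- Two lines of different classes meet. -/
theorem exists_mem_inter (hC : C ∈ A.classes) (hD : D ∈ A.classes) (hCD : C ≠ D) (hl : l ∈ C)
    (hm : m ∈ D) : ∃ p, p ∈ l ∧ p ∈ m := by
  by_contra hcon
  have hd : Disjoint m l := Set.disjoint_left.2 fun p hp hq => hcon ⟨p, hq, hp⟩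
  refine notMem_of_ne hD hC hCD.symm hm ?_
  rw [eq_classOf hC hl]
  exact ⟨mem_lines_of_mem hD hm, Or.inr hd⟩

/-- Two lines of different classes have only one common point. -/
theorem point_eq (hC : C ∈ A.classes) (hD : D ∈ A.classes) (hCD : C ≠ D) (hl : l ∈ C)
    (hm : m ∈ D) (hpl : p ∈ l) (hpm : p ∈ m) (hql : q ∈ l) (hqm : q ∈ m) : p = q := by
  by_contra hpq
  have := line_eq (mem_lines_of_mem hC hl) (mem_lines_of_mem hD hm) hpq hpl hql hpm hqm
  exact notMem_of_ne hC hD hCD hl (this ▸ hm)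

theorem exists_line_of_two (hC : C ∈ A.classes) (p q : P) : ∃ l ∈ A.lines, p ∈ l ∧ q ∈ l := by
  by_cases hpq : p = q
  · obtain ⟨l, hl, hp⟩ := exists_line_through hC p
    exact ⟨l, mem_lines_of_mem hC hl, hp, hpq ▸ hp⟩
  · exact (A.join p q hpq).exists

/-- There are at least three parallel classes. -/
theorem exists_third_class (hC : C ∈ A.classes) (D : Set (Set P)) :
    ∃ E ∈ A.classes, E ≠ C ∧ E ≠ D := by
  obtain ⟨p, q, r, h⟩ := A.triangle
  obtain ⟨l₁, h₁, p₁, q₁⟩ := exists_line_of_two hC p q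
  obtain ⟨l₂, h₂, q₂, r₂⟩ := exists_line_of_two hC q r
  obtain ⟨l₃, h₃, r₃, p₃⟩ := exists_line_of_two hC r p
  -- Two sides of the triangle share a vertex, so if they were parallel they would coincide and
  -- contain all three vertices. The three sides thus have distinct classes, which cannot all be
  -- among `C` and `D`.
  have key : ∀ {l m x}, l ∈ A.lines → m ∈ A.lines → x ∈ l → x ∈ m → A.classOf l = A.classOf m →
      l = m := fun hl hm hxl hxm he =>
    eq_of_mem (classOf_mem hl) (mem_classOf hl) (he ▸ mem_classOf hm) hxl hxm
  have n₁₂ : A.classOf l₁ ≠ A.classOf l₂ := fun he => h l₁ h₁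
    ⟨p₁, q₁, (key h₁ h₂ q₁ q₂ he).symm ▸ r₂⟩
  have n₁₃ : A.classOf l₁ ≠ A.classOf l₃ := fun he => h l₁ h₁
    ⟨p₁, q₁, (key h₁ h₃ p₁ p₃ he).symm ▸ r₃⟩
  have n₂₃ : A.classOf l₂ ≠ A.classOf l₃ := fun he => h l₂ h₂
    ⟨(key h₂ h₃ r₂ r₃ he).symm ▸ p₃, q₂, r₂⟩
  by_contra hcon
  push Not at hcon
  have c₁ := hcon _ (classOf_mem h₁)
  have c₂ := hcon _ (classOf_mem h₂)
  have c₃ := hcon _ (classOf_mem h₃)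
  by_cases e₁ : A.classOf l₁ = C
  · have e₂ := c₂ fun e => n₁₂ (e₁.trans e.symm)
    exact n₂₃ (e₂.trans (c₃ fun e => n₁₃ (e₁.trans e.symm)).symm)
  · by_cases e₂ : A.classOf l₂ = C
    · exact n₁₃ ((c₁ e₁).trans (c₃ fun e => n₂₃ (e₂.trans e.symm)).symm)
    · exact n₁₂ ((c₁ e₁).trans (c₂ e₂).symm)

/-! ### Cardinalities -/

/-- The line of a given class through a point. -/
noncomputable def lineThrough (hC : C ∈ A.classes) (p : P) : C :=
  ⟨(exists_line_through hC p).choose, (exists_line_through hC p).choose_spec.1⟩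

theorem mem_lineThrough (hC : C ∈ A.classes) (p : P) : p ∈ (lineThrough hC p : Set P) :=
  (exists_line_through hC p).choose_spec.2

theorem lineThrough_eq (hC : C ∈ A.classes) (l : C) (hp : p ∈ (l : Set P)) :
    lineThrough hC p = l :=
  Subtype.ext (eq_of_mem hC (lineThrough hC p).2 l.2 (mem_lineThrough hC p) hp)

/-- A point is the intersection of its lines in two given classes. -/
noncomputable def pointEquiv (hC : C ∈ A.classes) (hD : D ∈ A.classes) (hCD : C ≠ D) :
    P ≃ C × D :=
  Equiv.ofBijective (fun p => (lineThrough hC p, lineThrough hD p)) (by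
    constructor
    · intro p q hpq
      have h₁ := congrArg Prod.fst hpq
      have h₂ := congrArg Prod.snd hpq
      simp only at h₁ h₂
      refine point_eq hC hD hCD (lineThrough hC p).2 (lineThrough hD p).2 (mem_lineThrough hC p)
        (mem_lineThrough hD p) ?_ ?_
      · rw [h₁]; exact mem_lineThrough hC q
      · rw [h₂]; exact mem_lineThrough hD q
    · rintro ⟨l, m⟩
      obtain ⟨p, hpl, hpm⟩ := exists_mem_inter hC hD hCD l.2 m.2
      exact ⟨p, Prod.ext (lineThrough_eq hC l hpl) (lineThrough_eq hD m hpm)⟩)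

/-- The points of a line correspond to the lines of any other class. -/
noncomputable def lineEquiv (hC : C ∈ A.classes) (hD : D ∈ A.classes) (hCD : C ≠ D) (hl : l ∈ C) :
    l ≃ D :=
  Equiv.ofBijective (fun p => lineThrough hD p) (by
    constructor
    · intro p q hpq
      refine Subtype.ext (point_eq hC hD hCD hl (lineThrough hD p).2 p.2 (mem_lineThrough hD p)
        q.2 ?_)
      simp only at hpq
      rw [hpq]; exact mem_lineThrough hD q
    · intro m
      obtain ⟨p, hpl, hpm⟩ := exists_mem_inter hC hD hCD hl m.2
      exact ⟨⟨p, hpl⟩, lineThrough_eq hD m hpm⟩)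

theorem exists_notMem (hl : l ∈ A.lines) : ∃ p, p ∉ l := by
  by_contra hcon
  push Not at hcon
  obtain ⟨p, q, r, h⟩ := A.triangle
  exact h l hl ⟨hcon p, hcon q, hcon r⟩

variable [Fintype P]

/-- For three distinct classes, `pointEquiv` shows that the sizes of any two multiply to $n^2$;
hence all three sizes equal $n$. -/
theorem card_class (hP : Fintype.card P = n ^ 2) (hC : C ∈ A.classes) : Nat.card C = n := by
  obtain ⟨D, hD, hDC, -⟩ := exists_third_class hC C
  obtain ⟨E, hE, hEC, hED⟩ := exists_third_class hC D
  have h : ∀ {X Y : Set (Set P)} (_ : X ∈ A.classes) (_ : Y ∈ A.classes) (_ : X ≠ Y),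
      Nat.card X * Nat.card Y = n ^ 2 := by
    intro X Y hX hY hXY
    rw [← Nat.card_prod, ← Nat.card_congr (pointEquiv hX hY hXY), Nat.card_eq_fintype_card, hP]
  have h₁ := h hC hD hDC.symm
  have h₂ := h hC hE hEC.symm
  have h₃ := h hD hE hED.symm
  have hpos : 0 < Nat.card C := by
    have := (class_nonempty hC).to_subtype
    have : Finite C := Set.toFinite C
    exact Nat.card_pos
  have hDE : Nat.card D = Nat.card E := Nat.eq_of_mul_eq_mul_left hpos (h₁.trans h₂.symm)
  have hD' : Nat.card D = n := by
    rw [← hDE, ← pow_two] at h₃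
    exact Nat.pow_left_injective (n := 2) (by norm_num) h₃
  have hn : 0 < n := by
    rcases Nat.eq_zero_or_pos n with rfl | hn
    · rw [zero_pow two_ne_zero, Fintype.card_eq_zero_iff] at hP
      obtain ⟨l, hl⟩ := class_nonempty hC
      obtain ⟨p, -⟩ := line_nonempty (mem_lines_of_mem hC hl)
      exact (hP.false p).elim
    · exact hn
  rw [hD', pow_two] at h₁
  exact Nat.eq_of_mul_eq_mul_right hn h₁

theorem card_line (hP : Fintype.card P = n ^ 2) (hl : l ∈ A.lines) : Nat.card l = n := by
  obtain ⟨D, hD, hDC, -⟩ := exists_third_class (classOf_mem hl) (A.classOf l)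
  rw [Nat.card_congr (lineEquiv (classOf_mem hl) hD hDC.symm (mem_classOf hl)), card_class hP hD]

/-- Fix a line of `C` and a point off it. Joining that point to the points of the line meets each
class other than `C` exactly once. -/
theorem card_otherClasses (hP : Fintype.card P = n ^ 2) (hC : C ∈ A.classes) :
    Nat.card {D // D ∈ A.classes ∧ D ≠ C} = n := by
  obtain ⟨l, hl⟩ := class_nonempty hC
  have hll := mem_lines_of_mem hC hl
  obtain ⟨p, hp⟩ := exists_notMem hll
  rw [← card_line hP hll]
  have hne : ∀ q : l, p ≠ q := fun q h => hp (h ▸ q.2)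
  refine (Nat.card_congr (Equiv.ofBijective
    (fun q : l => (⟨A.classOf (A.join p q (hne q)).exists.choose,
      classOf_mem (A.join p q (hne q)).exists.choose_spec.1, ?_⟩ :
        {D // D ∈ A.classes ∧ D ≠ C})) ⟨?_, ?_⟩)).symm
  · intro he
    obtain ⟨hm, hpm, hqm⟩ := (A.join p q (hne q)).exists.choose_spec
    have : l = _ := eq_of_mem hC hl (he ▸ mem_classOf hm) q.2 hqm
    exact hp (this ▸ hpm)
  · intro q r hqr
    obtain ⟨hm, hpm, hqm⟩ := (A.join p q (hne q)).exists.choose_spec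
    obtain ⟨hm', hpm', hrm⟩ := (A.join p r (hne r)).exists.choose_spec
    have he := congrArg Subtype.val hqr
    simp only at he
    have hmm := eq_of_mem (classOf_mem hm) (mem_classOf hm) (he ▸ mem_classOf hm') hpm hpm'
    by_contra hqr'
    have := line_eq hm hll (fun h => hqr' (Subtype.ext h)) hqm (hmm ▸ hrm) q.2 r.2
    exact hp (this ▸ hpm)
  · rintro ⟨D, hD, hDC⟩
    obtain ⟨m, hm, hpm⟩ := exists_line_through hD p
    obtain ⟨q, hql, hqm⟩ := exists_mem_inter hC hD hDC.symm hl hm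
    refine ⟨⟨q, hql⟩, Subtype.ext ?_⟩
    obtain ⟨hm', hpm', hqm'⟩ := (A.join p q (hne ⟨q, hql⟩)).exists.choose_spec
    have := line_eq (mem_lines_of_mem hD hm) hm' (hne ⟨q, hql⟩) hpm hqm hpm' hqm'
    simp only
    rw [← this, eq_classOf hD hm]

/-! ### The affine plane over a field -/

/-- The vertical line with abscissa `c`. -/
def vertical {F : Type u} (c : F) : Set (F × F) := {x | x.1 = c}

/-- The line with slope `m` and intercept `b`. -/
def sloped {F : Type u} [Field F] (m b : F) : Set (F × F) := {x | x.2 = m * x.1 + b}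

theorem mem_vertical {F : Type u} {c : F} {x : F × F} : x ∈ vertical c ↔ x.1 = c := Iff.rfl

theorem mem_sloped {F : Type u} [Field F] {m b : F} {x : F × F} :
    x ∈ sloped m b ↔ x.2 = m * x.1 + b := Iff.rfl

theorem not_disjoint_vertical_sloped {F : Type u} [Field F] (c m b : F) :
    ¬ Disjoint (vertical c) (sloped m b) :=
  Set.not_disjoint_iff.2 ⟨(c, m * c + b), rfl, rfl⟩

theorem eq_of_disjoint_sloped {F : Type u} [Field F] {m b m' b' : F}
    (h : Disjoint (sloped m b) (sloped m' b')) : m = m' := by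
  by_contra hm
  have hm' : m - m' ≠ 0 := sub_ne_zero.2 hm
  refine absurd h (Set.not_disjoint_iff.2
    ⟨((b' - b) / (m - m'), m * ((b' - b) / (m - m')) + b), mem_sloped.2 rfl, mem_sloped.2 ?_⟩)
  simp only
  field_simp
  ring

/-- The affine plane over a field. -/
def ofField (F : Type u) [Field F] : AffinePlane (F × F) where
  lines := {l | (∃ c, l = vertical c) ∨ ∃ m b, l = sloped m b}
  two_points := by
    rintro l (⟨c, rfl⟩ | ⟨m, b, rfl⟩)
    · exact ⟨(c, 0), rfl, (c, 1), rfl, fun h => zero_ne_one (congrArg Prod.snd h)⟩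
    · exact ⟨(0, m * 0 + b), rfl, (1, m * 1 + b), rfl, fun h => zero_ne_one (congrArg Prod.fst h)⟩
  join := by
    rintro ⟨x, y⟩ ⟨x', y'⟩ hpq
    by_cases hx : x = x'
    · subst hx
      have hy : y ≠ y' := fun h => hpq (by rw [h])
      refine ⟨vertical x, ⟨Or.inl ⟨x, rfl⟩, rfl, rfl⟩, ?_⟩
      rintro l ⟨⟨c, rfl⟩ | ⟨m, b, rfl⟩, hp, hq⟩
      · rw [mem_vertical] at hp
        rw [show x = c from hp]
      · rw [mem_sloped] at hp hq
        exact absurd (hp.trans hq.symm) hy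
    · have hx' : x' - x ≠ 0 := sub_ne_zero.2 fun h => hx h.symm
      refine ⟨sloped ((y' - y) / (x' - x)) (y - (y' - y) / (x' - x) * x),
        ⟨Or.inr ⟨_, _, rfl⟩, ?_, ?_⟩, ?_⟩
      · rw [mem_sloped]; ring
      · rw [mem_sloped]; field_simp; ring
      · rintro l ⟨⟨c, rfl⟩ | ⟨m, b, rfl⟩, hp, hq⟩
        · exact absurd ((mem_vertical.1 hp).trans (mem_vertical.1 hq).symm) hx
        · rw [mem_sloped] at hp hq
          simp only at hp hq
          have hm : m = (y' - y) / (x' - x) := by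
            rw [eq_div_iff hx', hp, hq]; ring
          rw [← hm]
          congr 1
          rw [hp]; ring
  playfair := by
    rintro l (⟨c, rfl⟩ | ⟨m, b, rfl⟩) ⟨x, y⟩ hp
    · refine ⟨vertical x, ⟨Or.inl ⟨x, rfl⟩, rfl, ?_⟩, ?_⟩
      · exact Set.disjoint_left.2 fun z hz hz' => hp (hz.symm.trans hz')
      · rintro l ⟨⟨c', rfl⟩ | ⟨m, b, rfl⟩, hpl, hd⟩
        · rw [show x = c' from hpl]
        · exact absurd hd.symm (not_disjoint_vertical_sloped c m b)
    · refine ⟨sloped m (y - m * x), ⟨Or.inr ⟨_, _, rfl⟩, ?_, ?_⟩, ?_⟩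
      · rw [mem_sloped]; ring
      · refine Set.disjoint_left.2 fun z hz hz' => hp ?_
        rw [mem_sloped] at hz hz' ⊢
        simp only
        linear_combination hz' - hz
      · rintro l ⟨⟨c', rfl⟩ | ⟨m', b', rfl⟩, hpl, hd⟩
        · exact absurd hd (not_disjoint_vertical_sloped c' m b)
        · obtain rfl := eq_of_disjoint_sloped hd
          rw [mem_sloped] at hpl
          congr 1
          simp only at hpl
          rw [hpl]; ring
  triangle := by
    refine ⟨(0, 0), (1, 0), (0, 1), ?_⟩
    rintro l (⟨c, rfl⟩ | ⟨m, b, rfl⟩) ⟨h₁, h₂, h₃⟩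
    · exact zero_ne_one ((mem_vertical.1 h₁).trans (mem_vertical.1 h₂).symm)
    · rw [mem_sloped] at h₁ h₃
      exact zero_ne_one (h₁.trans h₃.symm)

theorem exists_affinePlane {q : ℕ} (hq : IsPrimePow q) :
    ∃ (P : Type) (_ : Fintype P) (_ : AffinePlane P), Fintype.card P = q ^ 2 := by
  obtain ⟨p, k, hp, hk, rfl⟩ := hq
  have : Fact p.Prime := ⟨hp.nat_prime⟩
  have hc : Nat.card (GaloisField p k) = p ^ k := GaloisField.card p k hk.ne'
  have : Finite (GaloisField p k) :=
    Nat.finite_of_card_ne_zero (hc ▸ (pow_pos hp.nat_prime.pos k).ne')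
  let : Fintype (GaloisField p k × GaloisField p k) := Fintype.ofFinite _
  refine ⟨GaloisField p k × GaloisField p k, inferInstance, ofField _, ?_⟩
  rw [← Nat.card_eq_fintype_card, Nat.card_prod, hc, pow_two]

end AffinePlane
end PowerChoosability

/-! ### The vertices of $G$ and their partition. -/

namespace PowerChoosability
namespace AffinePlane

variable {P : Type u} {A : AffinePlane P} {C D C₀ C₁ : Set (Set P)} {a l : Set P} {p q : P}
  {n k : ℕ}

/-! ### The vertices of `G` -/

theorem Edge.eq_of {e f : A.Edge C₀} (hp : e.pt = f.pt) (hl : e.line = f.line) : e = f := by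
  cases e; cases f; cases hp; cases hl; rfl

theorem node_zero (e : A.Edge C₀) : A.node C₀ C₁ k e 0 = .point e.pt := by
  simp [node]

theorem node_of_inner (e : A.Edge C₀) (m : Fin (k + 1))
    (h : 1 ≤ (m : ℕ) ∧ ((m : ℕ) < k ∨ ((m : ℕ) = k ∧ e.line ∉ C₁))) :
    A.node C₀ C₁ k e m = .inner e m h := by
  have h0 : (m : ℕ) ≠ 0 := by omega
  have h1 : ¬ ((m : ℕ) = k ∧ e.line ∈ C₁) := fun hc =>
    h.2.elim (fun hlt => hlt.ne hc.1) fun h' => h'.2 hc.2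
  simp only [node, dif_neg h0, dif_neg h1]

theorem node_last (hk : 1 ≤ k) (e : A.Edge C₀) (he : e.line ∈ C₁) :
    A.node C₀ C₁ k e (Fin.last k) = .line e.line he := by
  have h0 : ((Fin.last k : Fin (k + 1)) : ℕ) ≠ 0 := by simp; omega
  have h1 : ((Fin.last k : Fin (k + 1)) : ℕ) = k ∧ e.line ∈ C₁ := ⟨by simp, he⟩
  simp only [node, dif_neg h0, dif_pos h1]

/-- The three kinds of nodes. -/
theorem node_cases (e : A.Edge C₀) (m : Fin (k + 1)) :
    m = 0 ∨ (m = Fin.last k ∧ e.line ∈ C₁) ∨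
      (1 ≤ (m : ℕ) ∧ ((m : ℕ) < k ∨ ((m : ℕ) = k ∧ e.line ∉ C₁))) := by
  by_cases h0 : m = 0
  · exact Or.inl h0
  · have h0' : (m : ℕ) ≠ 0 := fun h => h0 (Fin.ext h)
    have hm : (m : ℕ) ≤ k := Nat.lt_succ_iff.1 m.isLt
    by_cases hk : m = Fin.last k
    · by_cases he : e.line ∈ C₁
      · exact Or.inr (Or.inl ⟨hk, he⟩)
      · exact Or.inr (Or.inr ⟨by omega, Or.inr ⟨by rw [hk]; simp, he⟩⟩)
    · have : (m : ℕ) ≠ k := fun h => hk (Fin.ext (by simpa using h))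
      exact Or.inr (Or.inr ⟨by omega, Or.inl (by omega)⟩)

theorem level_node (hk : 1 ≤ k) (e : A.Edge C₀) (m : Fin (k + 1)) :
    (A.node C₀ C₁ k e m).level = m := by
  rcases node_cases (C₁ := C₁) e m with rfl | ⟨rfl, he⟩ | h
  · rw [node_zero]; rfl
  · rw [node_last hk e he]; simp [Vertex.level]
  · rw [node_of_inner e m h]; rfl

/-- The level recovers the index. Nodes of different edges are identified only at the ends of the
paths: at a common point, or at a common line of `C₁`. -/
theorem node_eq_node (hk : 1 ≤ k) {e f : A.Edge C₀} {i j : Fin (k + 1)}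
    (h : A.node C₀ C₁ k e i = A.node C₀ C₁ k f j) :
    i = j ∧ (e = f ∨ (i = 0 ∧ e.pt = f.pt) ∨
      (i = Fin.last k ∧ e.line = f.line ∧ e.line ∈ C₁)) := by
  have hij : i = j := by
    have := congrArg Vertex.level h
    rw [level_node hk, level_node hk] at this
    exact Fin.ext this
  subst hij
  refine ⟨rfl, ?_⟩
  have hk0 : (0 : Fin (k + 1)) ≠ Fin.last k := fun h => by
    have := congrArg Fin.val h; simp at this; omega
  rcases node_cases (C₁ := C₁) e i with rfl | ⟨rfl, he⟩ | hi
  · rw [node_zero, node_zero] at h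
    exact Or.inr (Or.inl ⟨rfl, Vertex.point.inj h⟩)
  · rw [node_last hk e he] at h
    rcases node_cases (C₁ := C₁) f (Fin.last k) with h0 | ⟨-, hf⟩ | hi
    · exact absurd h0.symm hk0
    · rw [node_last hk f hf] at h
      exact Or.inr (Or.inr ⟨rfl, Vertex.line.inj h, he⟩)
    · rw [node_of_inner f _ hi] at h
      cases h
  · rw [node_of_inner e _ hi] at h
    rcases node_cases (C₁ := C₁) f i with rfl | ⟨rfl, hf⟩ | hi'
    · simp at hi
    · rw [node_last hk f hf] at h
      cases h
    · rw [node_of_inner f _ hi'] at h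
      exact Or.inl (Vertex.inner.inj h).1

/-- The edge through a point whose line belongs to a given class. -/
noncomputable def edgeThrough (hC₀ : C₀ ∈ A.classes) (hC : C ∈ A.classes) (hne : C ≠ C₀) (p : P) :
    A.Edge C₀ where
  pt := p
  line := lineThrough hC p
  line_mem := mem_lines_of_mem hC (lineThrough hC p).2
  line_notMem := notMem_of_ne hC hC₀ hne (lineThrough hC p).2
  incident := mem_lineThrough hC p

theorem Edge.class_ne (e : A.Edge C₀) : A.classOf e.line ≠ C₀ := fun h =>
  e.line_notMem (h.subset (mem_classOf e.line_mem))

theorem Edge.eq_of_class {e f : A.Edge C₀} (hC : C ∈ A.classes) (hp : e.pt = f.pt)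
    (he : e.line ∈ C) (hf : f.line ∈ C) : e = f :=
  Edge.eq_of hp (eq_of_mem hC he hf e.incident (by rw [hp]; exact f.incident))

/-- Edges with points on one line of `C₀` and lines in one other class have equal points if they
have equal lines. -/
theorem Edge.eq_of_line {e f : A.Edge C₀} (hC₀ : C₀ ∈ A.classes) (ha : a ∈ C₀)
    (hl : e.line = f.line) (he : e.pt ∈ a) (hf : f.pt ∈ a) : e = f :=
  Edge.eq_of (point_eq (classOf_mem e.line_mem) hC₀ e.class_ne (mem_classOf e.line_mem) ha
    e.incident he (by rw [hl]; exact f.incident) hf) hl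

theorem exists_node (hk : 1 ≤ k) (hC₀ : C₀ ∈ A.classes) (hC₁ : C₁ ∈ A.classes) (hne : C₁ ≠ C₀)
    (v : Vertex A C₀ C₁ k) : ∃ e m, v = A.node C₀ C₁ k e m := by
  cases v with
  | point p => exact ⟨edgeThrough hC₀ hC₁ hne p, 0, (node_zero (edgeThrough hC₀ hC₁ hne p)).symm⟩
  | inner e m h =>
    exact ⟨e, ⟨m, by omega⟩, (node_of_inner e ⟨m, by omega⟩ h).symm⟩
  | line l h =>
    obtain ⟨p, hp⟩ := line_nonempty (mem_lines_of_mem hC₁ h)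
    let e : A.Edge C₀ := ⟨p, l, mem_lines_of_mem hC₁ h, notMem_of_ne hC₁ hC₀ hne h, hp⟩
    exact ⟨e, Fin.last k, (node_last hk e h).symm⟩

/-! ### The parts -/

theorem exists_mem_part (hk : 1 ≤ k) (hC₀ : C₀ ∈ A.classes) (hC₁ : C₁ ∈ A.classes)
    (hne : C₁ ≠ C₀) (v : Vertex A C₀ C₁ k) :
    ∃ a ∈ C₀, ∃ C ∈ A.classes, C ≠ C₀ ∧ ∃ m : Fin (k + 1), (m : ℕ) = v.level ∧
      v ∈ A.part C₀ C₁ k a C m := by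
  obtain ⟨e, m, rfl⟩ := exists_node hk hC₀ hC₁ hne v
  obtain ⟨a, ha, hp⟩ := exists_line_through hC₀ e.pt
  exact ⟨a, ha, A.classOf e.line, classOf_mem e.line_mem, e.class_ne, m,
    (level_node hk e m).symm, e, hp, mem_classOf e.line_mem, rfl⟩

/-- Every point lies on a line of `C`, so at level 0 the class is irrelevant and only the line `a`
distinguishes the parts. -/
theorem part_zero (hC₀ : C₀ ∈ A.classes) (hC : C ∈ A.classes) (hne : C ≠ C₀) :
    A.part C₀ C₁ k a C 0 = {v | ∃ p ∈ a, v = .point p} := by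
  ext v
  constructor
  · rintro ⟨e, he, -, rfl⟩
    exact ⟨e.pt, he, node_zero e⟩
  · rintro ⟨p, hp, rfl⟩
    exact ⟨edgeThrough hC₀ hC hne p, hp, (lineThrough hC p).2,
      (node_zero (edgeThrough hC₀ hC hne p)).symm⟩

/-- Every line of `C₁` meets `a`, so these parts coincide for all `a` in `C₀`. -/
theorem part_last (hk : 1 ≤ k) (hC₀ : C₀ ∈ A.classes) (hC₁ : C₁ ∈ A.classes) (hne : C₁ ≠ C₀)
    (ha : a ∈ C₀) : A.part C₀ C₁ k a C₁ (Fin.last k) = {v | ∃ l, ∃ h : l ∈ C₁, v = .line l h} := by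
  ext v
  constructor
  · rintro ⟨e, -, he, rfl⟩
    exact ⟨e.line, he, node_last hk e he⟩
  · rintro ⟨l, hl, rfl⟩
    obtain ⟨p, hpa, hpl⟩ := exists_mem_inter hC₀ hC₁ hne.symm ha hl
    let e : A.Edge C₀ := ⟨p, l, mem_lines_of_mem hC₁ hl, notMem_of_ne hC₁ hC₀ hne hl, hpl⟩
    exact ⟨e, hpa, hl, (node_last hk e hl).symm⟩

/-- The ways in which nodes can coincide, listed in `node_eq_node`, match the coincidences of parts
in `part_zero` and `part_last`. -/
theorem part_eq_of_mem (hk : 1 ≤ k) (hC₀ : C₀ ∈ A.classes) (hC₁ : C₁ ∈ A.classes) (hne : C₁ ≠ C₀)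
    {a a' : Set P} (ha : a ∈ C₀) (ha' : a' ∈ C₀) (hC : C ∈ A.classes) (hCne : C ≠ C₀)
    (hD : D ∈ A.classes) (hDne : D ≠ C₀) {m m' : Fin (k + 1)} {v : Vertex A C₀ C₁ k}
    (hv : v ∈ A.part C₀ C₁ k a C m) (hv' : v ∈ A.part C₀ C₁ k a' D m') :
    A.part C₀ C₁ k a C m = A.part C₀ C₁ k a' D m' := by
  obtain ⟨e, hea, heC, rfl⟩ := hv
  obtain ⟨f, hfa, hfD, hef⟩ := hv'
  obtain ⟨rfl, rfl | ⟨rfl, hp⟩ | ⟨rfl, hl, he⟩⟩ := node_eq_node hk hef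
  · rw [eq_of_mem hC₀ ha ha' hea hfa, class_eq hC hD heC hfD]
  · rw [part_zero hC₀ hC hCne, part_zero hC₀ hD hDne, eq_of_mem hC₀ ha ha' hea (hp ▸ hfa)]
  · rw [class_eq hC hC₁ heC he, class_eq hD hC₁ hfD (hl ▸ he), part_last hk hC₀ hC₁ hne ha,
      part_last hk hC₀ hC₁ hne ha']

/-- The part is an injective image of `a`. Injectivity persists at a line vertex because a line of
`C` meets `a` in only one point. -/
theorem ncard_part [Fintype P] (hP : Fintype.card P = n ^ 2) (hk : 1 ≤ k) (hC₀ : C₀ ∈ A.classes)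
    (ha : a ∈ C₀) (hC : C ∈ A.classes) (hne : C ≠ C₀) (m : Fin (k + 1)) :
    (A.part C₀ C₁ k a C m).ncard = n := by
  have himg : A.part C₀ C₁ k a C m =
      (fun p => A.node C₀ C₁ k (edgeThrough hC₀ hC hne p) m) '' a := by
    ext v
    constructor
    · rintro ⟨e, hea, heC, rfl⟩
      refine ⟨e.pt, hea, ?_⟩
      have : edgeThrough hC₀ hC hne e.pt = e :=
        Edge.eq_of_class hC rfl (lineThrough hC e.pt).2 heC
      simp only [this]
    · rintro ⟨p, hp, rfl⟩
      exact ⟨edgeThrough hC₀ hC hne p, hp, (lineThrough hC p).2, rfl⟩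
  rw [himg, Set.InjOn.ncard_image]
  · exact card_line hP (mem_lines_of_mem hC₀ ha)
  · intro p hp q hq hpq
    rcases (node_eq_node hk hpq).2 with h | ⟨-, h⟩ | ⟨-, h, -⟩
    · exact congrArg Edge.pt h
    · exact h
    · exact congrArg Edge.pt (Edge.eq_of_line hC₀ ha h hp hq)

/-! ### Counting vertices -/

/-- An edge is given by its point and the class of its line. -/
noncomputable def edgeEquiv (hC₀ : C₀ ∈ A.classes) :
    P × {D // D ∈ A.classes ∧ D ≠ C₀} ≃ A.Edge C₀ :=
  Equiv.ofBijective (fun x => edgeThrough hC₀ x.2.2.1 x.2.2.2 x.1) (by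
    constructor
    · rintro ⟨p, D, hD⟩ ⟨q, E, hE⟩ h
      have hp : p = q := congrArg Edge.pt h
      have hl : (lineThrough hD.1 p : Set P) = lineThrough hE.1 q := congrArg Edge.line h
      have hDE : D = E := class_eq hD.1 hE.1 (lineThrough hD.1 p).2 (hl ▸ (lineThrough hE.1 q).2)
      subst hp hDE
      rfl
    · intro e
      exact ⟨(e.pt, ⟨A.classOf e.line, classOf_mem e.line_mem, e.class_ne⟩),
        Edge.eq_of_class (classOf_mem e.line_mem) rfl (lineThrough (classOf_mem e.line_mem) e.pt).2
          (mem_classOf e.line_mem)⟩)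

/-- An edge with line in a given class is given by its point. -/
noncomputable def edgeClassEquiv (hC₀ : C₀ ∈ A.classes) (hC : C ∈ A.classes) (hne : C ≠ C₀) :
    P ≃ {e : A.Edge C₀ // e.line ∈ C} :=
  Equiv.ofBijective (fun p => ⟨edgeThrough hC₀ hC hne p, (lineThrough hC p).2⟩) (by
    constructor
    · intro p q h
      exact congrArg (fun e => Edge.pt e.1) h
    · rintro ⟨e, he⟩
      exact ⟨e.pt, Subtype.ext (Edge.eq_of_class hC rfl (lineThrough hC e.pt).2 he)⟩)

theorem finite_edge [Finite P] (hC₀ : C₀ ∈ A.classes) : Finite (A.Edge C₀) :=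
  Finite.of_equiv _ (edgeEquiv hC₀)

theorem card_edge [Fintype P] (hP : Fintype.card P = n ^ 2) (hC₀ : C₀ ∈ A.classes) :
    Nat.card (A.Edge C₀) = n ^ 3 := by
  rw [← Nat.card_congr (edgeEquiv hC₀), Nat.card_prod, card_otherClasses hP hC₀,
    Nat.card_eq_fintype_card, hP]
  ring

/-- The vertices below level `k`. -/
def lowEquiv (hk : 1 ≤ k) :
    P ⊕ (A.Edge C₀ × Fin (k - 1)) ≃ {v : Vertex A C₀ C₁ k // v.level < k} where
  toFun
    | .inl p => ⟨.point p, hk⟩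
    | .inr (e, i) => ⟨.inner e (i + 1) ⟨by omega, Or.inl (by omega)⟩, by
        change (i : ℕ) + 1 < k; omega⟩
  invFun
    | ⟨.point p, _⟩ => .inl p
    | ⟨.inner e m h, hm⟩ => .inr (e, ⟨m - 1, by change m < k at hm; omega⟩)
    | ⟨.line _ _, hm⟩ => absurd hm (lt_irrefl k)
  left_inv := by
    rintro (p | ⟨e, i⟩) <;> rfl
  right_inv := by
    rintro ⟨p | ⟨e, m, h⟩ | ⟨l, h⟩, hm⟩
    · rfl
    · have : m - 1 + 1 = m := by omega
      simp only [this]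
    · exact absurd hm (lt_irrefl k)

/-- The vertices at level `k`. -/
def highEquiv (hk : 1 ≤ k) :
    {e : A.Edge C₀ // e.line ∉ C₁} ⊕ C₁ ≃ {v : Vertex A C₀ C₁ k // ¬ v.level < k} where
  toFun
    | .inl e => ⟨.inner e.1 k ⟨hk, Or.inr ⟨rfl, e.2⟩⟩, lt_irrefl k⟩
    | .inr l => ⟨.line l.1 l.2, lt_irrefl k⟩
  invFun
    | ⟨.point _, hm⟩ => absurd (Nat.lt_of_lt_of_le Nat.zero_lt_one hk) hm
    | ⟨.inner e _ h, hm⟩ => .inl ⟨e, (h.2.resolve_left hm).2⟩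
    | ⟨.line l h, _⟩ => .inr ⟨l, h⟩
  left_inv := by
    rintro (e | l) <;> rfl
  right_inv := by
    rintro ⟨p | ⟨e, m, h⟩ | ⟨l, h⟩, hm⟩
    · exact absurd (Nat.lt_of_lt_of_le Nat.zero_lt_one hk) hm
    · obtain rfl : m = k := (h.2.resolve_left hm).1
      rfl
    · rfl

theorem finite_vertex [Finite P] (hk : 1 ≤ k) (hC₀ : C₀ ∈ A.classes) :
    Finite (Vertex A C₀ C₁ k) := by
  have := finite_edge hC₀
  have := Finite.of_equiv _ (lowEquiv (A := A) (C₀ := C₀) (C₁ := C₁) hk)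
  have := Finite.of_equiv _ (highEquiv (A := A) (C₀ := C₀) (C₁ := C₁) hk)
  exact Finite.of_equiv _ (Equiv.sumCompl fun v : Vertex A C₀ C₁ k => v.level < k)

theorem card_low [Fintype P] (hP : Fintype.card P = n ^ 2) (hk : 1 ≤ k) (hC₀ : C₀ ∈ A.classes) :
    Nat.card {v : Vertex A C₀ C₁ k // v.level < k} = n ^ 2 + n ^ 3 * (k - 1) := by
  have := finite_edge hC₀
  rw [← Nat.card_congr (lowEquiv hk), Nat.card_sum, Nat.card_prod, card_edge hP hC₀,
    Nat.card_eq_fintype_card, hP, Nat.card_eq_fintype_card, Fintype.card_fin]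

theorem card_vertex [Fintype P] (hP : Fintype.card P = n ^ 2) (hk : 1 ≤ k) (hC₀ : C₀ ∈ A.classes)
    (hC₁ : C₁ ∈ A.classes) (hne : C₁ ≠ C₀) : Nat.card (Vertex A C₀ C₁ k) = k * n ^ 3 + n := by
  classical
  have := finite_edge hC₀
  have := finite_vertex (C₁ := C₁) hk hC₀
  -- At level `k` the $n^2$ edges with line in `C₁` contribute only the $n$ lines themselves; adding
  -- $n^2$ on the left avoids truncated subtraction.
  have h₁ : Nat.card {v : Vertex A C₀ C₁ k // ¬ v.level < k} + n ^ 2 = n ^ 3 + n := by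
    have h := Nat.card_congr (Equiv.sumCompl fun e : A.Edge C₀ => e.line ∈ C₁)
    rw [Nat.card_sum, card_edge hP hC₀, ← Nat.card_congr (edgeClassEquiv hC₀ hC₁ hne),
      Nat.card_eq_fintype_card, hP] at h
    rw [← Nat.card_congr (highEquiv hk), Nat.card_sum, card_class hP hC₁]
    omega
  rw [← Nat.card_congr (Equiv.sumCompl fun v : Vertex A C₀ C₁ k => v.level < k), Nat.card_sum,
    card_low hP hk hC₀]
  obtain ⟨j, rfl⟩ : ∃ j, k = j + 1 := ⟨k - 1, by omega⟩
  rw [Nat.add_sub_cancel]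
  linarith

/-- The number of parts is found by dividing a vertex count by $n$, so the coincidences among the
indexing triples need not be counted. -/
theorem ncard_sUnion_of_disjoint {V : Type*} [Finite V] {F : Set (Set V)}
    (hF : ∀ S ∈ F, ∀ T ∈ F, ∀ v ∈ S, v ∈ T → S = T) (hn : ∀ S ∈ F, S.ncard = n) :
    (⋃₀ F).ncard = n * F.ncard := by
  classical
  have := Fintype.ofFinite V
  have := Fintype.ofFinite F
  rw [Set.sUnion_eq_iUnion, Set.ncard_iUnion_of_finite (fun _ => Set.toFinite _),
    finsum_eq_sum_of_fintype, Finset.sum_congr rfl fun S _ => hn S.1 S.2]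
  · rw [Finset.sum_const, smul_eq_mul, Finset.card_univ, ← Nat.card_eq_fintype_card, mul_comm]
    rfl
  · intro S T hST
    exact Set.disjoint_left.2 fun v hv hv' => hST (Subtype.ext (hF _ S.2 _ T.2 v hv hv'))

theorem parts_eq_of_mem (hk : 1 ≤ k) (hC₀ : C₀ ∈ A.classes) (hC₁ : C₁ ∈ A.classes)
    (hne : C₁ ≠ C₀) {S T : Set (Vertex A C₀ C₁ k)} (hS : S ∈ A.parts C₀ C₁ k)
    (hT : T ∈ A.parts C₀ C₁ k) {v : Vertex A C₀ C₁ k} (hv : v ∈ S) (hv' : v ∈ T) : S = T := by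
  obtain ⟨a, ha, C, hC, hCne, m, rfl⟩ := hS
  obtain ⟨b, hb, D, hD, hDne, i, rfl⟩ := hT
  exact part_eq_of_mem hk hC₀ hC₁ hne ha hb hC hCne hD hDne hv hv'

theorem lowParts_subset : A.lowParts C₀ C₁ k ⊆ A.parts C₀ C₁ k := by
  rintro S ⟨a, ha, C, hC, hCne, m, -, rfl⟩
  exact ⟨a, ha, C, hC, hCne, m, rfl⟩

theorem ncard_of_mem_parts [Fintype P] (hP : Fintype.card P = n ^ 2) (hk : 1 ≤ k)
    (hC₀ : C₀ ∈ A.classes) {S : Set (Vertex A C₀ C₁ k)} (hS : S ∈ A.parts C₀ C₁ k) :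
    S.ncard = n := by
  obtain ⟨a, ha, C, hC, hCne, m, rfl⟩ := hS
  exact ncard_part hP hk hC₀ ha hC hCne m

theorem sUnion_parts (hk : 1 ≤ k) (hC₀ : C₀ ∈ A.classes) (hC₁ : C₁ ∈ A.classes) (hne : C₁ ≠ C₀) :
    ⋃₀ A.parts C₀ C₁ k = Set.univ := by
  refine Set.eq_univ_of_forall fun v => ?_
  obtain ⟨a, ha, C, hC, hCne, m, -, hv⟩ := exists_mem_part hk hC₀ hC₁ hne v
  exact ⟨_, ⟨a, ha, C, hC, hCne, m, rfl⟩, hv⟩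

theorem sUnion_lowParts (hk : 1 ≤ k) (hC₀ : C₀ ∈ A.classes) (hC₁ : C₁ ∈ A.classes)
    (hne : C₁ ≠ C₀) : ⋃₀ A.lowParts C₀ C₁ k = {v | v.level < k} := by
  ext v
  constructor
  · rintro ⟨S, ⟨a, ha, C, hC, hCne, m, hm, rfl⟩, e, -, -, rfl⟩
    change (A.node C₀ C₁ k e m).level < k
    rwa [level_node hk]
  · intro hv
    obtain ⟨a, ha, C, hC, hCne, m, hm, hvm⟩ := exists_mem_part hk hC₀ hC₁ hne v
    exact ⟨_, ⟨a, ha, C, hC, hCne, m, hm ▸ hv, rfl⟩, hvm⟩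

theorem order_pos [Fintype P] (hP : Fintype.card P = n ^ 2) (hC : C ∈ A.classes) : 0 < n := by
  rw [← card_class hP hC]
  have := (class_nonempty hC).to_subtype
  have : Finite C := Set.toFinite C
  exact Nat.card_pos

theorem isPartition_parts (hk : 1 ≤ k) (hC₀ : C₀ ∈ A.classes)
    (hC₁ : C₁ ∈ A.classes) (hne : C₁ ≠ C₀) : Setoid.IsPartition (A.parts C₀ C₁ k) := by
  constructor
  · rintro ⟨a, ha, C, hC, hCne, m, h⟩
    obtain ⟨p, hp⟩ := line_nonempty (mem_lines_of_mem hC₀ ha)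
    have : A.node C₀ C₁ k (edgeThrough hC₀ hC hCne p) m ∈ A.part C₀ C₁ k a C m :=
      ⟨_, hp, (lineThrough hC p).2, rfl⟩
    rw [← h] at this
    exact this
  · intro v
    obtain ⟨S, hS, hv⟩ : v ∈ ⋃₀ A.parts C₀ C₁ k := by
      rw [sUnion_parts hk hC₀ hC₁ hne]; exact Set.mem_univ v
    exact ⟨S, ⟨hS, hv⟩, fun T hT => parts_eq_of_mem hk hC₀ hC₁ hne hT.1 hS hT.2 hv⟩

theorem ncard_parts [Fintype P] (hP : Fintype.card P = n ^ 2) (hk : 1 ≤ k) (hC₀ : C₀ ∈ A.classes)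
    (hC₁ : C₁ ∈ A.classes) (hne : C₁ ≠ C₀) : (A.parts C₀ C₁ k).ncard = k * n ^ 2 + 1 := by
  have := finite_vertex (C₁ := C₁) hk hC₀
  have h := ncard_sUnion_of_disjoint (F := A.parts C₀ C₁ k)
    (fun S hS T hT v hv hv' => parts_eq_of_mem hk hC₀ hC₁ hne hS hT hv hv')
    (fun S hS => ncard_of_mem_parts hP hk hC₀ hS)
  rw [sUnion_parts hk hC₀ hC₁ hne, Set.ncard_univ, card_vertex hP hk hC₀ hC₁ hne] at h
  refine Nat.eq_of_mul_eq_mul_left (order_pos hP hC₀) (h.symm.trans ?_)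
  ring

theorem ncard_lowParts [Fintype P] (hP : Fintype.card P = n ^ 2) (hk : 1 ≤ k)
    (hC₀ : C₀ ∈ A.classes) (hC₁ : C₁ ∈ A.classes) (hne : C₁ ≠ C₀) :
    (A.lowParts C₀ C₁ k).ncard = (k - 1) * n ^ 2 + n := by
  have := finite_vertex (C₁ := C₁) hk hC₀
  have h := ncard_sUnion_of_disjoint (F := A.lowParts C₀ C₁ k)
    (fun S hS T hT v hv hv' => parts_eq_of_mem hk hC₀ hC₁ hne (lowParts_subset hS)
      (lowParts_subset hT) hv hv')
    (fun S hS => ncard_of_mem_parts hP hk hC₀ (lowParts_subset hS))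
  have h' : ({v | v.level < k} : Set (Vertex A C₀ C₁ k)).ncard = n ^ 2 + n ^ 3 * (k - 1) :=
    card_low hP hk hC₀
  rw [sUnion_lowParts hk hC₀ hC₁ hne, h'] at h
  refine Nat.eq_of_mul_eq_mul_left (order_pos hP hC₀) (h.symm.trans ?_)
  ring

end AffinePlane
end PowerChoosability

/-! ### Distances in $G$ and adjacency in $G^{4k}$. -/

namespace PowerChoosability
namespace AffinePlane

variable {P : Type u} {A : AffinePlane P} {C D C₀ C₁ : Set (Set P)} {a l : Set P} {p q : P}
  {n k : ℕ}

/-! ### Upper bounds for distances -/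

theorem edist_node_le (e : A.Edge C₀) {i j : Fin (k + 1)} (hij : i ≤ j) :
    (A.graph C₀ C₁ k).edist (A.node C₀ C₁ k e i) (A.node C₀ C₁ k e j) ≤
      (((j : ℕ) - (i : ℕ) : ℕ) : ℕ∞) := by
  induction j using Fin.induction with
  | zero =>
    obtain rfl : i = 0 := Fin.le_zero_iff.1 hij
    simp
  | succ j ih =>
    rcases hij.eq_or_lt with rfl | hlt
    · simp
    · have hle : i ≤ j.castSucc := Fin.le_castSucc_iff.2 hlt
      have hle' : (i : ℕ) ≤ j := hle
      have hstep : (A.graph C₀ C₁ k).edist (A.node C₀ C₁ k e j.castSucc)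
          (A.node C₀ C₁ k e j.succ) ≤ ((1 : ℕ) : ℕ∞) := by
        rw [Nat.cast_one, SimpleGraph.edist_le_one_iff_adj_or_eq]
        by_cases h : A.node C₀ C₁ k e j.castSucc = A.node C₀ C₁ k e j.succ
        · exact Or.inr h
        · exact Or.inl ⟨h, Or.inl (Or.inl ⟨e, j, rfl, rfl⟩)⟩
      refine edist_le_mono (edist_le_trans (ih hle) hstep) ?_
      simp only [Fin.val_castSucc, Fin.val_succ]
      omega

theorem edist_via_point {e f : A.Edge C₀} (h : e.pt = f.pt) (i j : Fin (k + 1)) :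
    (A.graph C₀ C₁ k).edist (A.node C₀ C₁ k e i) (A.node C₀ C₁ k f j) ≤
      (((i : ℕ) + (j : ℕ) : ℕ) : ℕ∞) := by
  have h₁ := edist_node_le (C₁ := C₁) e (Fin.zero_le i)
  have h₂ := edist_node_le (C₁ := C₁) f (Fin.zero_le j)
  rw [SimpleGraph.edist_comm] at h₁
  rw [node_zero, h, ← node_zero] at h₁
  exact edist_le_trans h₁ h₂

open Classical in
/-- Twice the length of the edge `pℓ` in the metric in which the clique around `ℓ` is replaced by a
star with edges of length `1 / 2`. -/
noncomputable def weight (C₁ : Set (Set P)) (k : ℕ) (l : Set P) : ℕ :=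
  if l ∈ C₁ then 2 * k else 2 * k + 1

/-- The route runs through the last nodes of both paths. These coincide if the line is in `C₁`, and
otherwise lie in a common clique, which costs one more step; `weight` records exactly this. -/
theorem edist_via_line (hk : 1 ≤ k) {e f : A.Edge C₀} (h : e.line = f.line) (i j : Fin (k + 1)) :
    (A.graph C₀ C₁ k).edist (A.node C₀ C₁ k e i) (A.node C₀ C₁ k f j) ≤
      ((weight C₁ k e.line - (i : ℕ) - (j : ℕ) : ℕ) : ℕ∞) := by
  have h₁ := edist_node_le (C₁ := C₁) e (Fin.le_last i)
  have h₂ := edist_node_le (C₁ := C₁) f (Fin.le_last j)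
  rw [SimpleGraph.edist_comm] at h₂
  have hmid : (A.graph C₀ C₁ k).edist (A.node C₀ C₁ k e (Fin.last k))
      (A.node C₀ C₁ k f (Fin.last k)) ≤ ((weight C₁ k e.line - 2 * k : ℕ) : ℕ∞) := by
    by_cases he : e.line ∈ C₁
    · have : A.node C₀ C₁ k e (Fin.last k) = A.node C₀ C₁ k f (Fin.last k) := by
        rw [node_last hk e he, node_last hk f (h ▸ he)]
        simp only [h]
      simp [this]
    · have : weight C₁ k e.line - 2 * k = 1 := by simp [weight, he]
      rw [this, Nat.cast_one, SimpleGraph.edist_le_one_iff_adj_or_eq]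
      by_cases hn : A.node C₀ C₁ k e (Fin.last k) = A.node C₀ C₁ k f (Fin.last k)
      · exact Or.inr hn
      · exact Or.inl ⟨hn, Or.inl (Or.inr ⟨e, f, h, he, rfl, rfl⟩)⟩
  refine edist_le_mono (edist_le_trans (edist_le_trans h₁ hmid) h₂) ?_
  have hi := i.isLt
  have hj := j.isLt
  simp only [weight, Fin.val_last]
  split_ifs <;> omega

/-- A bound for the distance of a point from a vertex, useful if the point is on a common line of
`C₀` with the point of that vertex. -/
theorem edist_point_le (hk : 1 ≤ k) (hC₀ : C₀ ∈ A.classes) (hC₁ : C₁ ∈ A.classes) (hne : C₁ ≠ C₀)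
    (e f : A.Edge C₀) (j : Fin (k + 1)) :
    (A.graph C₀ C₁ k).edist (A.node C₀ C₁ k e 0) (A.node C₀ C₁ k f j) ≤
      ((4 * k + 1 - (j : ℕ) : ℕ) : ℕ∞) := by
  -- `D` is chosen so that exactly one of its lines and `f.line` belongs to `C₁`; two lines outside
  -- `C₁` would give a bound larger by one.
  obtain ⟨D, hD, hDne, hDf, hw⟩ : ∃ D ∈ A.classes, D ≠ C₀ ∧ D ≠ A.classOf f.line ∧
      ∀ l ∈ D, weight C₁ k l + weight C₁ k f.line = 4 * k + 1 := by
    by_cases hf₁ : f.line ∈ C₁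
    · obtain ⟨D, hD, hDC₁, hDC₀⟩ := exists_third_class hC₁ C₀
      refine ⟨D, hD, hDC₀, fun h => hDC₁ (h.trans (eq_classOf hC₁ hf₁).symm), fun l hl => ?_⟩
      have hl₁ : l ∉ C₁ := notMem_of_ne hD hC₁ hDC₁ hl
      simp only [weight, hf₁, hl₁, if_true, if_false]
      omega
    · refine ⟨C₁, hC₁, hne, fun h => hf₁ (h ▸ mem_classOf f.line_mem), fun l hl => ?_⟩
      simp only [weight, hf₁, hl, if_true, if_false]
      omega
  obtain ⟨q, hq, hqf⟩ := exists_mem_inter hD (classOf_mem f.line_mem) hDf (lineThrough hD e.pt).2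
    (mem_classOf f.line_mem)
  let g := edgeThrough hC₀ hD hDne e.pt
  let g' : A.Edge C₀ := ⟨q, lineThrough hD e.pt, g.line_mem, g.line_notMem, hq⟩
  let f' : A.Edge C₀ := ⟨q, f.line, f.line_mem, f.line_notMem, hqf⟩
  have h₁ := edist_via_point (C₁ := C₁) (e := e) (f := g) rfl (0 : Fin (k + 1)) 0
  have h₂ := edist_via_line (C₁ := C₁) hk (e := g) (f := g') rfl (0 : Fin (k + 1)) 0
  have h₃ := edist_via_point (C₁ := C₁) (e := g') (f := f') rfl (0 : Fin (k + 1)) 0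
  have h₄ := edist_via_line (C₁ := C₁) hk (e := f') (f := f) rfl (0 : Fin (k + 1)) j
  refine edist_le_mono (edist_le_trans (edist_le_trans (edist_le_trans h₁ h₂) h₃) h₄) ?_
  have hw' : weight C₁ k g.line + weight C₁ k f'.line = 4 * k + 1 :=
    hw _ (lineThrough hD e.pt).2
  have hj : (j : ℕ) ≤ weight C₁ k f'.line := by
    have := j.isLt
    simp only [weight]; split_ifs <;> omega
  simp only [Fin.val_zero]
  omega

/-- Vertices below level `k` have distance at most `4 k` unless they belong to the same part. -/
theorem edist_le_four_mul (hk : 1 ≤ k) (hC₀ : C₀ ∈ A.classes) (hC₁ : C₁ ∈ A.classes)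
    (hne : C₁ ≠ C₀) {e f : A.Edge C₀} {i j : Fin (k + 1)} (hi : (i : ℕ) < k) (hj : (j : ℕ) < k)
    (h : ∀ a ∈ C₀, e.pt ∈ a → f.pt ∈ a →
      i ≠ j ∨ (i ≠ 0 ∧ A.classOf e.line ≠ A.classOf f.line)) :
    (A.graph C₀ C₁ k).edist (A.node C₀ C₁ k e i) (A.node C₀ C₁ k f j) ≤ ((4 * k : ℕ) : ℕ∞) := by
  by_cases hpt : e.pt = f.pt
  · exact edist_le_mono (edist_via_point hpt i j) (by omega)
  obtain ⟨m, ⟨hm, hem, hfm⟩, -⟩ := A.join e.pt f.pt hpt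
  by_cases hm₀ : m ∈ C₀
  · have hlt : ∀ {e f : A.Edge C₀} {i j : Fin (k + 1)}, i < j → (A.graph C₀ C₁ k).edist (A.node C₀ C₁ k e i) (A.node C₀ C₁ k f j) ≤
          ((4 * k : ℕ) : ℕ∞) := by
      intro e f i j hij
      have h₁ := edist_via_point (C₁ := C₁) (e := e) (f := e) rfl i 0
      have h₂ := edist_point_le hk hC₀ hC₁ hne e f j
      refine edist_le_mono (edist_le_trans h₁ h₂) ?_
      have : (i : ℕ) < j := hij
      have := j.isLt
      simp only [Fin.val_zero]
      omega
    rcases lt_trichotomy i j with hij | rfl | hij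
    · exact hlt hij
    · obtain ⟨hi0, hcl⟩ := (h m hm₀ hem hfm).resolve_left fun h => h rfl
      -- Both paths are followed away from their points, and the lines meet at `q`. The cost is at
      -- most $4k+2-2i$, so $i\ge 1$ is needed.
      obtain ⟨q, hqe, hqf⟩ := exists_mem_inter (classOf_mem e.line_mem) (classOf_mem f.line_mem)
        hcl (mem_classOf e.line_mem) (mem_classOf f.line_mem)
      let e' : A.Edge C₀ := ⟨q, e.line, e.line_mem, e.line_notMem, hqe⟩
      let f' : A.Edge C₀ := ⟨q, f.line, f.line_mem, f.line_notMem, hqf⟩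
      have h₁ := edist_via_line (C₁ := C₁) hk (e := e) (f := e') rfl i 0
      have h₂ := edist_via_point (C₁ := C₁) (e := e') (f := f') rfl (0 : Fin (k + 1)) 0
      have h₃ := edist_via_line (C₁ := C₁) hk (e := f') (f := f) rfl 0 i
      refine edist_le_mono (edist_le_trans (edist_le_trans h₁ h₂) h₃) ?_
      have : (i : ℕ) ≠ 0 := fun h => hi0 (Fin.ext h)
      simp only [Fin.val_zero, weight]
      split_ifs <;> omega
    · rw [SimpleGraph.edist_comm]
      exact hlt hij
  · let e' : A.Edge C₀ := ⟨e.pt, m, hm, hm₀, hem⟩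
    let f' : A.Edge C₀ := ⟨f.pt, m, hm, hm₀, hfm⟩
    have h₁ := edist_via_point (C₁ := C₁) (e := e) (f := e') rfl i 0
    have h₂ := edist_via_line (C₁ := C₁) hk (e := e') (f := f') rfl (0 : Fin (k + 1)) 0
    have h₃ := edist_via_point (C₁ := C₁) (e := f') (f := f) rfl 0 j
    refine edist_le_mono (edist_le_trans (edist_le_trans h₁ h₂) h₃) ?_
    simp only [Fin.val_zero, weight]
    split_ifs <;> omega

/-! ### Lower bounds for distances -/

/-- Potentials measure doubled distance, so that the half-edges of the stars replacing the cliques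
become integral. -/
theorem abs_sub_le_of_edist_le {V : Type u} {G : SimpleGraph V} (F : V → ℤ)
    (hF : ∀ u v, G.Adj u v → |F u - F v| ≤ 2) {u v : V} {N : ℕ} (h : G.edist u v ≤ (N : ℕ∞)) :
    |F u - F v| ≤ 2 * N := by
  obtain ⟨w, hw⟩ := exists_walk_of_edist_le h
  have key : |F u - F v| ≤ 2 * (w.length : ℤ) := by
    clear hw h
    induction w with
    | nil => simp
    | @cons x y z hxy w ih =>
      have h₁ := hF x y hxy
      have h₂ := abs_sub_le (F x) (F y) (F z)
      rw [SimpleGraph.Walk.length_cons]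
      push_cast
      linarith
  have : (w.length : ℤ) ≤ N := by exact_mod_cast hw
  linarith

open Classical in
/-- The extension of a potential on points and lines to the subdivision path of the edge `e`; the
potential is the distance from the node `i₀` of the edge `e₀`. -/
noncomputable def edgePotential (C₁ : Set (Set P)) (k : ℕ) (e₀ : A.Edge C₀) (i₀ : ℕ) (φ : P → ℤ)
    (ψ : Set P → ℤ) (e : A.Edge C₀) (i : ℕ) : ℤ :=
  if e = e₀ then max (2 * (i : ℤ) - 2 * i₀) (2 * i₀ - 2 * i)
  else min (φ e.pt + 2 * i) (ψ e.line + weight C₁ k e.line - 2 * i)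

/-- The extension of a potential on points and lines to the vertices of `G`. -/
noncomputable def vertexPotential (e₀ : A.Edge C₀) (i₀ : ℕ) (φ : P → ℤ) (ψ : Set P → ℤ) :
    Vertex A C₀ C₁ k → ℤ
  | .point p => φ p
  | .inner e i _ => edgePotential C₁ k e₀ i₀ φ ψ e i
  | .line l _ => ψ l

theorem weight_of_mem (h : l ∈ C₁) : weight C₁ k l = 2 * k := by simp [weight, h]

theorem weight_of_notMem (h : l ∉ C₁) : weight C₁ k l = 2 * k + 1 := by simp [weight, h]

/-- If a potential on points and lines is compatible with the weights then it bounds distances in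
`G` from below. -/
theorem potential_le (hk : 1 ≤ k) (e₀ : A.Edge C₀) (i₀ : Fin (k + 1)) (φ : P → ℤ) (ψ : Set P → ℤ)
    (hφ : φ e₀.pt = 2 * (i₀ : ℤ)) (hψ : ψ e₀.line = weight C₁ k e₀.line - 2 * (i₀ : ℤ))
    (h : ∀ e : A.Edge C₀, |φ e.pt - ψ e.line| ≤ weight C₁ k e.line)
    {f : A.Edge C₀} (hf : f ≠ e₀) (j : Fin (k + 1)) {N : ℕ}
    (hN : (A.graph C₀ C₁ k).edist (A.node C₀ C₁ k e₀ i₀) (A.node C₀ C₁ k f j) ≤ (N : ℕ∞)) :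
    min (φ f.pt + 2 * (j : ℤ)) (ψ f.line + weight C₁ k f.line - 2 * (j : ℤ)) ≤ 2 * (N : ℤ) := by
  have hi₀ := i₀.isLt
  have hnode : ∀ (e : A.Edge C₀) (i : Fin (k + 1)),
      vertexPotential e₀ i₀ φ ψ (A.node C₀ C₁ k e i) = edgePotential C₁ k e₀ i₀ φ ψ e i := by
    intro e i
    have he := abs_le.1 (h e)
    rcases node_cases (C₁ := C₁) e i with rfl | ⟨rfl, he₁⟩ | hi
    · rw [node_zero]
      simp only [vertexPotential, edgePotential]
      split_ifs with h₀
      · subst h₀; rw [hφ]; simp only [Fin.val_zero]; omega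
      · simp only [Fin.val_zero]; omega
    · rw [node_last hk e he₁]
      simp only [vertexPotential, edgePotential]
      rw [weight_of_mem he₁] at he ⊢
      split_ifs with h₀
      · subst h₀; rw [hψ, weight_of_mem he₁]; simp only [Fin.val_last]; push_cast; omega
      · simp only [Fin.val_last]; push_cast at he ⊢; omega
    · rw [node_of_inner e i hi]; rfl
  have hadj : ∀ u v, (A.graph C₀ C₁ k).Adj u v →
      |vertexPotential e₀ i₀ φ ψ u - vertexPotential e₀ i₀ φ ψ v| ≤ 2 := by
    have hone : ∀ u v : Vertex A C₀ C₁ k,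
        ((∃ (e : A.Edge C₀) (i : Fin k), u = A.node C₀ C₁ k e i.castSucc ∧
          v = A.node C₀ C₁ k e i.succ) ∨
        (∃ e f : A.Edge C₀, e.line = f.line ∧ e.line ∉ C₁ ∧
          u = A.node C₀ C₁ k e (Fin.last k) ∧ v = A.node C₀ C₁ k f (Fin.last k))) →
        |vertexPotential e₀ i₀ φ ψ u - vertexPotential e₀ i₀ φ ψ v| ≤ 2 := by
      rintro u v (⟨e, i, rfl, rfl⟩ | ⟨e, f, hl, he₁, rfl, rfl⟩)
      · rw [hnode, hnode]
        simp only [edgePotential, Fin.val_castSucc, Fin.val_succ]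
        have he := abs_le.1 (h e)
        rw [abs_le]
        push_cast
        split_ifs <;> omega
      -- The value `ψ e.line` serves as the centre of the star: every clique vertex is within 1 of
      -- it, hence any two are within 2 of each other.
      · have hclose : ∀ e : A.Edge C₀, e.line ∉ C₁ →
            |edgePotential C₁ k e₀ i₀ φ ψ e k - ψ e.line| ≤ 1 := by
          intro e he₁
          have he := abs_le.1 (h e)
          simp only [edgePotential]
          rw [abs_le]
          rw [weight_of_notMem he₁] at he ⊢
          split_ifs with h₀
          · subst h₀; rw [hψ, weight_of_notMem he₁]; push_cast; omega
          · push_cast at he ⊢; omega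
        rw [hnode, hnode]
        simp only [Fin.val_last]
        have h₁ := abs_le.1 (hclose e he₁)
        have h₂ := abs_le.1 (hclose f (hl ▸ he₁))
        rw [hl] at h₁
        exact abs_le.2 ⟨by omega, by omega⟩
    rintro u v ⟨-, huv | huv⟩
    · exact hone u v huv
    · rw [abs_sub_comm]; exact hone v u huv
  have key := abs_sub_le_of_edist_le _ hadj hN
  rw [hnode, hnode] at key
  have h₁ : edgePotential C₁ k e₀ i₀ φ ψ e₀ i₀ = 0 := by simp [edgePotential]
  have h₂ : edgePotential C₁ k e₀ i₀ φ ψ f j =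
      min (φ f.pt + 2 * (j : ℤ)) (ψ f.line + weight C₁ k f.line - 2 * (j : ℤ)) := by
    simp only [edgePotential, if_neg hf]
  rw [h₁, h₂] at key
  have := abs_le.1 key
  omega

open Classical in
/-- Different vertices of a part have distance more than `4 k`. -/
theorem four_mul_lt_edist (hk : 1 ≤ k) (hC₀ : C₀ ∈ A.classes) (hC₁ : C₁ ∈ A.classes)
    (hC : C ∈ A.classes) (hCne : C ≠ C₀) (ha : a ∈ C₀) {e f : A.Edge C₀} (hef : f ≠ e)
    (hea : e.pt ∈ a) (hfa : f.pt ∈ a) (heC : e.line ∈ C) (hfC : f.line ∈ C) (i : Fin (k + 1)) :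
    ¬ (A.graph C₀ C₁ k).edist (A.node C₀ C₁ k e i) (A.node C₀ C₁ k f i) ≤
      ((4 * k : ℕ) : ℕ∞) := by
  intro hN
  have hpt : f.pt ≠ e.pt := fun h => hef (Edge.eq_of_class hC h hfC heC)
  have hline : f.line ≠ e.line := fun h => hef (Edge.eq_of_line hC₀ ha h hfa hea)
  have hfe : f.pt ∉ e.line := fun h => hline (eq_of_mem hC hfC heC f.incident h)
  have hik : (i : ℕ) ≤ k := Nat.lt_succ_iff.1 i.isLt
  -- `T` is the value needed at `f.pt`: climbing to level `i` adds `2 * i` and gives $8k+1$. The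
  -- value of `ψ` on the other lines of `C` gives the same $8k+1$ from the line end. The remaining
  -- values follow the doubled lengths of routes through `e.pt` or `e.line`, with the points off `a`
  -- and `e.line` capped at `T`.
  let T : ℤ := 8 * k + 1 - 2 * (i : ℤ)
  let φ : P → ℤ := fun q =>
    if q = e.pt then 2 * (i : ℤ)
    else if q ∈ e.line then 2 * (weight C₁ k e.line : ℤ) - 2 * (i : ℤ)
    else if q ∈ a then T
    else if ∃ m ∈ C₁, e.pt ∈ m ∧ q ∈ m then min (2 * (i : ℤ) + 4 * k) T
    else min (2 * (i : ℤ) + 4 * k + 2) T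
  let ψ : Set P → ℤ := fun m =>
    if m = e.line then weight C₁ k e.line - 2 * (i : ℤ)
    else if m ∈ C then 8 * k + 1 - weight C₁ k e.line + 2 * (i : ℤ)
    else if e.pt ∈ m then 2 * (i : ℤ) + weight C₁ k m
    else T - weight C₁ k m
  -- The facts `f₁` to `f₁₀` are all the plane geometry required; the inequality is then a finite
  -- case check on the position of `g.pt` and `g.line`.
  have hcomp : ∀ g : A.Edge C₀, |φ g.pt - ψ g.line| ≤ weight C₁ k g.line := by
    intro g
    have hg := g.incident
    have hgC₀ := g.line_notMem
    have hee := e.incident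
    have f₁ : g.line ∈ C → ∀ x ∈ e.line, x ∈ g.line → g.line = e.line :=
      fun h x hx hx' => eq_of_mem hC h heC hx' hx
    have f₂ : g.pt ≠ e.pt → g.pt ∈ e.line → e.pt ∈ g.line → g.line = e.line :=
      fun h h₁ h₂ => line_eq g.line_mem e.line_mem h hg h₂ h₁ hee
    have f₃ : g.pt ≠ e.pt → g.pt ∈ a → e.pt ∉ g.line := fun h h₁ h₂ =>
      hgC₀ (line_eq g.line_mem (mem_lines_of_mem hC₀ ha) h hg h₂ h₁ hea ▸ ha)
    have f₄ : g.pt ≠ e.pt → e.pt ∈ g.line →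
        (g.line ∈ C₁ ↔ ∃ m ∈ C₁, e.pt ∈ m ∧ g.pt ∈ m) := fun h h₁ =>
      ⟨fun h₂ => ⟨_, h₂, h₁, hg⟩, fun ⟨m, hm, hem, hgm⟩ =>
        line_eq g.line_mem (mem_lines_of_mem hC₁ hm) h hg h₁ hgm hem ▸ hm⟩
    have f₅ : g.pt ∉ e.line → ¬ (e.line ∈ C₁ ∧ ∃ m ∈ C₁, e.pt ∈ m ∧ g.pt ∈ m) := by
      rintro h ⟨h₁, m, hm, hem, hgm⟩
      exact h (eq_of_mem hC₁ hm h₁ hem hee ▸ hgm)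
    have f₆ : e.pt ∉ g.line → ¬ (g.line ∈ C₁ ∧ ∃ m ∈ C₁, e.pt ∈ m ∧ g.pt ∈ m) := by
      rintro h ⟨h₁, m, hm, hem, hgm⟩
      exact h (eq_of_mem hC₁ hm h₁ hgm hg ▸ hem)
    have f₇ : g.line ∈ C → (g.line ∈ C₁ ↔ e.line ∈ C₁) := fun h =>
      ⟨fun h₁ => class_eq hC hC₁ h h₁ ▸ heC, fun h₁ => class_eq hC hC₁ heC h₁ ▸ h⟩
    have f₈ : g.line ∉ C → ¬ (g.line ∈ C₁ ∧ e.line ∈ C₁) := fun h h₁ =>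
      h (class_eq hC hC₁ heC h₁.2 ▸ h₁.1)
    have f₉ : g.line = e.line → g.pt ∈ e.line ∧ e.pt ∈ g.line := fun h => ⟨h ▸ hg, h ▸ hee⟩
    have f₁₀ : g.pt = e.pt → e.pt ∈ g.line := fun h => h ▸ hg
    rw [abs_le]
    simp only [φ, ψ, T]
    generalize (∃ m ∈ C₁, e.pt ∈ m ∧ g.pt ∈ m) = H at f₄ f₅ f₆ ⊢
    have w₁ : weight C₁ k g.line = if g.line ∈ C₁ then 2 * k else 2 * k + 1 := rfl
    have w₂ : weight C₁ k e.line = if e.line ∈ C₁ then 2 * k else 2 * k + 1 := rfl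
    by_cases hq : g.pt = e.pt
    · grind
    · by_cases hql : g.pt ∈ e.line
      · grind
      · by_cases hqa : g.pt ∈ a
        · grind
        · grind
  have key := potential_le hk e i φ ψ (by simp [φ]) (by simp [ψ]) hcomp hef i hN
  have hwf : weight C₁ k f.line = weight C₁ k e.line := by
    have : f.line ∈ C₁ ↔ e.line ∈ C₁ :=
      ⟨fun h => class_eq hC hC₁ hfC h ▸ heC, fun h => class_eq hC hC₁ heC h ▸ hfC⟩
    simp only [weight, this]
  simp only [φ, ψ, if_neg hpt, if_neg hfe, if_pos hfa, if_neg hline, if_pos hfC, hwf, T] at key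
  push_cast at key
  omega

theorem isIndepSet_part (hk : 1 ≤ k) (hC₀ : C₀ ∈ A.classes) (hC₁ : C₁ ∈ A.classes)
    {S : Set (Vertex A C₀ C₁ k)} (hS : S ∈ A.parts C₀ C₁ k) :
    (power (A.graph C₀ C₁ k) (4 * k)).IsIndepSet S := by
  obtain ⟨a, ha, C, hC, hCne, m, rfl⟩ := hS
  rintro _ ⟨e, hea, heC, rfl⟩ _ ⟨f, hfa, hfC, rfl⟩ hne hadj
  exact four_mul_lt_edist hk hC₀ hC₁ hC hCne ha (fun h => hne (by rw [h])) hea hfa heC hfC m hadj.2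

theorem adj_power_iff (hk : 1 ≤ k) (hC₀ : C₀ ∈ A.classes) (hC₁ : C₁ ∈ A.classes)
    (hne : C₁ ≠ C₀) {u v : Vertex A C₀ C₁ k} (hu : u.level < k) (hv : v.level < k) :
    (power (A.graph C₀ C₁ k) (4 * k)).Adj u v ↔ ∀ S ∈ A.lowParts C₀ C₁ k, u ∈ S → v ∉ S := by
  constructor
  · intro hadj S hS huS hvS
    exact isIndepSet_part hk hC₀ hC₁ (lowParts_subset hS) huS hvS hadj.1 hadj
  · intro h
    obtain ⟨e, i, rfl⟩ := exists_node hk hC₀ hC₁ hne u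
    obtain ⟨f, j, rfl⟩ := exists_node hk hC₀ hC₁ hne v
    rw [level_node hk] at hu hv
    constructor
    · intro heq
      have hmem : A.node C₀ C₁ k e i ∈ ⋃₀ A.lowParts C₀ C₁ k := by
        rw [sUnion_lowParts hk hC₀ hC₁ hne]
        change (A.node C₀ C₁ k e i).level < k
        rwa [level_node hk]
      obtain ⟨S, hS, heS⟩ := hmem
      exact h S hS heS (heq ▸ heS)
    · refine edist_le_four_mul hk hC₀ hC₁ hne hu hv fun a ha hea hfa => ?_
      by_contra hcon
      push Not at hcon
      obtain ⟨rfl, hcon⟩ := hcon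
      refine h (A.part C₀ C₁ k a (A.classOf e.line) i)
        ⟨a, ha, _, classOf_mem e.line_mem, e.class_ne, i, hu, rfl⟩
        ⟨e, hea, mem_classOf e.line_mem, rfl⟩ ?_
      -- At level 0 the classes of the two edges may differ, but there the part does not depend on
      -- the class.
      by_cases hi : i = 0
      · subst hi
        rw [part_zero hC₀ (classOf_mem e.line_mem) e.class_ne, node_zero]
        exact ⟨f.pt, hfa, rfl⟩
      · exact ⟨f, hfa, hcon hi ▸ mem_classOf f.line_mem, rfl⟩

end AffinePlane
end PowerChoosability

/-! ### Asymptotic estimates and the constant. -/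

namespace PowerChoosability

/-! ### Estimates -/

theorem log_sixteen_bounds : 1 ≤ Real.log 16 ∧ Real.log 16 ≤ 3 := by
  have h : Real.log 16 = 4 * Real.log 2 := by
    rw [show (16 : ℝ) = 2 ^ 4 by norm_num, Real.log_pow]; norm_num
  have h₁ := Real.log_two_gt_d9
  have h₂ := Real.log_two_lt_d9
  constructor <;> linarith

theorem natLog_le_log {n : ℕ} (hn : 1 ≤ n) : (Nat.log 16 n : ℝ) ≤ Real.log n := by
  have h : ((16 : ℝ) ^ Nat.log 16 n) ≤ n := by exact_mod_cast Nat.pow_log_le_self 16 (by omega)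
  have h' := Real.log_le_log (by positivity) h
  rw [Real.log_pow] at h'
  nlinarith [log_sixteen_bounds.1, (Nat.cast_nonneg (Nat.log 16 n) : (0 : ℝ) ≤ _)]

theorem log_le_six_mul {n : ℕ} (hn : 16 ≤ n) : Real.log n ≤ 6 * (Nat.log 16 n : ℝ) := by
  have h : (n : ℝ) ≤ (16 : ℝ) ^ (Nat.log 16 n + 1) := by
    exact_mod_cast (Nat.lt_pow_succ_log_self (by norm_num) n).le
  have h' := Real.log_le_log (by exact_mod_cast (by omega : 0 < n)) h
  rw [Real.log_pow] at h'
  have ht : (1 : ℝ) ≤ Nat.log 16 n := by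
    exact_mod_cast (Nat.le_log_iff_pow_le (by norm_num) (by omega)).2 (by simpa using hn)
  push_cast at h'
  nlinarith [log_sixteen_bounds.2]

/-- With $t=\lfloor\log_{16}n\rfloor$ the binomial coefficient is at most $n^{4t}\le e^{4\log^2 n}$.
The base 16 gives $4^t\le\sqrt n$, so the power is at most $e^{-\sqrt n}$, which wins. -/
theorem choose_mul_pow_lt_one {n s : ℕ} (hn : 1 ≤ n) (hs : s ≤ n ^ 4)
    (hlog : 4 * Real.log n ^ 2 < Real.sqrt n) :
    (s.choose (Nat.log 16 n) : ℝ) * (1 - ((4 : ℝ) ^ Nat.log 16 n)⁻¹) ^ n < 1 := by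
  set t := Nat.log 16 n with ht
  have hn0 : (0 : ℝ) < n := by exact_mod_cast hn
  have hlog0 : 0 ≤ Real.log n := Real.log_nonneg (by exact_mod_cast hn)
  have htl : (t : ℝ) ≤ Real.log n := natLog_le_log hn
  have h₁ : (s.choose t : ℝ) ≤ Real.exp (4 * Real.log n ^ 2) := by
    calc (s.choose t : ℝ) ≤ ((s ^ t : ℕ) : ℝ) := by exact_mod_cast Nat.choose_le_pow s t
      _ ≤ (((n ^ 4) ^ t : ℕ) : ℝ) := by exact_mod_cast Nat.pow_le_pow_left hs t
      _ = Real.exp (t * (4 * Real.log n)) := by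
          rw [Real.exp_nat_mul, show (4 : ℝ) * Real.log n = ((4 : ℕ) : ℝ) * Real.log n by norm_num,
            Real.exp_nat_mul, Real.exp_log hn0]
          push_cast; rfl
      _ ≤ _ := Real.exp_le_exp.2 (by nlinarith)
  have h4 : (4 : ℝ) ^ t ≤ Real.sqrt n := by
    refine Real.le_sqrt_of_sq_le ?_
    rw [← pow_mul, mul_comm, pow_mul]
    norm_num
    exact_mod_cast Nat.pow_log_le_self 16 (by omega)
  have hp1 : ((4 : ℝ) ^ t)⁻¹ ≤ 1 := inv_le_one_of_one_le₀ (one_le_pow₀ (by norm_num))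
  have hsqrt : 0 < Real.sqrt n := Real.sqrt_pos.2 hn0
  have h₂ : (1 - ((4 : ℝ) ^ t)⁻¹) ^ n ≤ Real.exp (-Real.sqrt n) := by
    calc (1 - ((4 : ℝ) ^ t)⁻¹) ^ n ≤ Real.exp (-((4 : ℝ) ^ t)⁻¹) ^ n :=
          pow_le_pow_left₀ (by linarith) (Real.one_sub_le_exp_neg _) n
      _ = Real.exp (n * -((4 : ℝ) ^ t)⁻¹) := (Real.exp_nat_mul _ _).symm
      _ ≤ _ := by
          refine Real.exp_le_exp.2 ?_
          have : (Real.sqrt n)⁻¹ ≤ ((4 : ℝ) ^ t)⁻¹ := inv_anti₀ (by positivity) h4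
          have h' : Real.sqrt n = n * (Real.sqrt n)⁻¹ := by
            field_simp
            exact Real.sq_sqrt hn0.le
          rw [h']
          nlinarith
  calc (s.choose t : ℝ) * (1 - ((4 : ℝ) ^ t)⁻¹) ^ n
      ≤ Real.exp (4 * Real.log n ^ 2) * Real.exp (-Real.sqrt n) :=
        mul_le_mul h₁ h₂ (pow_nonneg (by linarith) n) (Real.exp_pos _).le
    _ = Real.exp (4 * Real.log n ^ 2 - Real.sqrt n) := by rw [← Real.exp_add]; rfl
    _ < 1 := by rw [← Real.exp_zero]; exact Real.exp_lt_exp.2 (by linarith)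

theorem eventually_log_sq_lt_sqrt :
    ∀ᶠ n : ℕ in Filter.atTop, 4 * Real.log n ^ 2 < Real.sqrt n := by
  have h := (isLittleO_log_rpow_rpow_atTop 2 (show (0 : ℝ) < 1 / 2 by norm_num)).bound
    (show (0 : ℝ) < 1 / 5 by norm_num)
  filter_upwards [tendsto_natCast_atTop_atTop.eventually h, Filter.eventually_ge_atTop 1]
    with n hn h1
  have hn0 : (0 : ℝ) < n := by exact_mod_cast h1
  have hsqrt : 0 < Real.sqrt n := Real.sqrt_pos.2 hn0
  rw [← Real.sqrt_eq_rpow, Real.rpow_two, Real.norm_of_nonneg (sq_nonneg _),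
    Real.norm_of_nonneg hsqrt.le] at hn
  linarith

/-- The gap between the chromatic numbers for a graph with at most `k n² + 1` independent classes
that contains a large complete multipartite graph with parts of size `n`. -/
theorem listGap_of_multipartite {V : Type} [Finite V] (G : SimpleGraph V) {k n r : ℕ} (hk : 2 ≤ k)
    (hn : 16 ≤ n) (hr : r = (k - 1) * n ^ 2 + n) (hkn : k ≤ n) (hlog : 4 * Real.log n ^ 2 < Real.sqrt n)
    (hcol : G.Colorable (k * n ^ 2 + 1)) (ι : Fin r × Fin n → V)
    (hι : Function.Injective ι)
    (hadj : ∀ i j x y, i ≠ j → G.Adj (ι (i, x)) (ι (j, y))) :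
    (n : ℕ∞) ≤ G.chromaticNumber ∧ ListGap (1 / 100) G := by
  obtain ⟨j, rfl⟩ : ∃ j, k = j + 1 := ⟨k - 1, by omega⟩
  rw [Nat.add_sub_cancel] at hr
  set t := Nat.log 16 n with ht
  have hj : 1 ≤ j := by omega
  have hr4 : r ≤ n ^ 3 := by
    have : n ≤ n ^ 2 := Nat.le_self_pow (by norm_num) n
    calc r ≤ j * n ^ 2 + 1 * n ^ 2 := by omega
      _ = (j + 1) * n ^ 2 := by ring
      _ ≤ n * n ^ 2 := Nat.mul_le_mul_right _ hkn
      _ = n ^ 3 := by ring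
  have hrt : r * t ≤ n ^ 4 :=
    (Nat.mul_le_mul hr4 (Nat.log_le_self 16 n)).trans (by rw [← pow_succ])
  have hnr : n ≤ r := by omega
  have hnot := not_choosable_of_multipartite G ι hι hadj (by omega)
    (choose_mul_pow_lt_one (by omega) hrt hlog)
  obtain ⟨y, hy, hdy⟩ := exists_listChromaticNumber G hnot
  obtain ⟨x, hx⟩ := ENat.ne_top_iff_exists.1
    (ne_top_of_le_ne_top (ENat.natCast_ne_top _) hcol.chromaticNumber_le)
  have hxle : x ≤ (j + 1) * n ^ 2 + 1 := by
    have := hcol.chromaticNumber_le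
    rw [← hx] at this
    exact_mod_cast this
  -- One vertex from each part gives a clique of size `r`.
  have hrx : r ≤ x := by
    have : ((r : ℕ) : ℕ∞) ≤ G.chromaticNumber :=
      SimpleGraph.le_chromaticNumber_of_pairwise_adj (by simp)
        (fun i : Fin r => ι (i, ⟨0, by omega⟩)) fun i i' h => hadj _ _ _ _ h
    rw [← hx] at this
    exact_mod_cast this
  refine ⟨by rw [← hx]; exact_mod_cast hnr.trans hrx, x, y, hx.symm, hy, ?_⟩
  -- This is where $k\ge 2$ matters: for $k=1$ the multipartite subgraph would have only $n$ parts
  -- against $n^2+1$ colours.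
  have hx2 : x ≤ 2 * r := by
    have : (j + 1) * n ^ 2 ≤ 2 * (j * n ^ 2) := by
      calc (j + 1) * n ^ 2 ≤ (2 * j) * n ^ 2 := Nat.mul_le_mul_right _ (by omega)
        _ = _ := by ring
    omega
  have hx4 : x ≤ n ^ 4 := by
    have : n ^ 3 + 1 ≤ n ^ 4 := by
      have : 0 < n ^ 3 := by positivity
      calc n ^ 3 + 1 ≤ n ^ 3 * 2 := by omega
        _ ≤ n ^ 3 * n := Nat.mul_le_mul_left _ (by omega)
        _ = n ^ 4 := by ring
    calc x ≤ (j + 1) * n ^ 2 + 1 := hxle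
      _ ≤ n * n ^ 2 + 1 := Nat.add_le_add_right (Nat.mul_le_mul_right _ hkn) 1
      _ = n ^ 3 + 1 := by ring
      _ ≤ n ^ 4 := this
  have hlogx : Real.log x ≤ 24 * (t : ℝ) := by
    have h₁ : Real.log x ≤ Real.log ((n : ℝ) ^ 4) :=
      Real.log_le_log (by exact_mod_cast (by omega : 0 < x)) (by exact_mod_cast hx4)
    rw [Real.log_pow] at h₁
    have h₂ := log_le_six_mul hn
    push_cast at h₁
    linarith
  have hy2 : (r : ℝ) * t ≤ 2 * y := by
    have hdy' : r * t / 2 < y := hdy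
    have : r * t ≤ 2 * y := by omega
    exact_mod_cast this
  have hx2' : (x : ℝ) ≤ 2 * r := by exact_mod_cast hx2
  have ht0 : (0 : ℝ) ≤ t := Nat.cast_nonneg t
  have hx0 : (0 : ℝ) ≤ x := Nat.cast_nonneg x
  -- The factors are 2 from `hx2`, 24 from `hlogx` and 2 from `hy2`; their product 96 is below 100.
  calc 1 / 100 * (x : ℝ) * Real.log x ≤ 1 / 100 * (x : ℝ) * (24 * t) :=
        mul_le_mul_of_nonneg_left hlogx (by positivity)
    _ ≤ 1 / 100 * (2 * r) * (24 * t) := by gcongr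
    _ ≤ y := by nlinarith [mul_nonneg (Nat.cast_nonneg (α := ℝ) r) ht0]

/-! ### The gap for powers of $G$ and its consequences. -/

theorem AffinePlane.listGap_graph {P : Type} [Fintype P] {A : AffinePlane P} {C₀ C₁ : Set (Set P)}
    {k n : ℕ} (hP : Fintype.card P = n ^ 2) (hC₀ : C₀ ∈ A.classes) (hC₁ : C₁ ∈ A.classes)
    (hne : C₁ ≠ C₀) (hk : 2 ≤ k) (hn : 16 ≤ n) (hkn : k ≤ n)
    (hlog : 4 * Real.log n ^ 2 < Real.sqrt n) :
    (n : ℕ∞) ≤ (power (A.graph C₀ C₁ k) (4 * k)).chromaticNumber ∧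
      ListGap (1 / 100) (power (A.graph C₀ C₁ k) (4 * k)) := by
  have hk1 : 1 ≤ k := by omega
  have := finite_vertex (C₁ := C₁) hk1 hC₀
  have hcol : (power (A.graph C₀ C₁ k) (4 * k)).Colorable (k * n ^ 2 + 1) := by
    have hpart : ∀ v, ∃ S ∈ A.parts C₀ C₁ k, v ∈ S := fun v => by
      have : v ∈ ⋃₀ A.parts C₀ C₁ k := by
        rw [sUnion_parts hk1 hC₀ hC₁ hne]; exact Set.mem_univ v
      exact this
    choose S hS hvS using hpart
    have := Fintype.ofFinite (A.parts C₀ C₁ k)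
    have hcol := (SimpleGraph.Coloring.mk (G := power (A.graph C₀ C₁ k) (4 * k))
      (fun v => (⟨S v, hS v⟩ : A.parts C₀ C₁ k)) fun {u v} huv h => by
        have he : S u = S v := congrArg Subtype.val h
        exact isIndepSet_part hk1 hC₀ hC₁ (hS u) (hvS u) (he ▸ hvS v) huv.1 huv).colorable
    rwa [← Nat.card_eq_fintype_card, show Nat.card (A.parts C₀ C₁ k) = k * n ^ 2 + 1 from
      ncard_parts hP hk1 hC₀ hC₁ hne] at hcol
  have hlow : Nat.card (A.lowParts C₀ C₁ k) = (k - 1) * n ^ 2 + n :=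
    ncard_lowParts hP hk1 hC₀ hC₁ hne
  let E : A.lowParts C₀ C₁ k ≃ Fin ((k - 1) * n ^ 2 + n) := Finite.equivFinOfCardEq hlow
  have hsize : ∀ S : A.lowParts C₀ C₁ k, Nat.card (S : Set (Vertex A C₀ C₁ k)) = n := fun S =>
    ncard_of_mem_parts hP hk1 hC₀ (lowParts_subset S.2)
  let ι : Fin ((k - 1) * n ^ 2 + n) × Fin n → Vertex A C₀ C₁ k := fun z =>
    ((Finite.equivFinOfCardEq (hsize (E.symm z.1))).symm z.2 : _)
  have hι : ∀ z, ι z ∈ (E.symm z.1 : Set (Vertex A C₀ C₁ k)) := fun z =>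
    ((Finite.equivFinOfCardEq (hsize (E.symm z.1))).symm z.2).2
  have hEq : ∀ {S T v}, S ∈ A.lowParts C₀ C₁ k → T ∈ A.lowParts C₀ C₁ k → v ∈ S → v ∈ T → S = T :=
    fun hS hT => parts_eq_of_mem hk1 hC₀ hC₁ hne (lowParts_subset hS) (lowParts_subset hT)
  have hlevel : ∀ z, (ι z).level < k := fun z => by
    have : ι z ∈ ⋃₀ A.lowParts C₀ C₁ k := ⟨_, (E.symm z.1).2, hι z⟩
    rwa [sUnion_lowParts hk1 hC₀ hC₁ hne] at this
  refine listGap_of_multipartite _ hk hn rfl hkn hlog hcol ι ?_ ?_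
  · rintro ⟨i, x⟩ ⟨j, y⟩ h
    have hij : i = j := by
      have := hEq (E.symm i).2 (E.symm j).2 (hι (i, x)) (h ▸ hι (j, y))
      exact E.symm.injective (Subtype.ext this)
    subst hij
    have := (Finite.equivFinOfCardEq (hsize (E.symm i))).symm.injective (Subtype.ext h)
    exact Prod.ext rfl this
  · intro i j x y hij
    rw [adj_power_iff hk1 hC₀ hC₁ hne (hlevel _) (hlevel _)]
    intro S hS hx hy
    have h₁ := hEq hS (E.symm i).2 hx (hι (i, x))
    have h₂ := hEq hS (E.symm j).2 hy (hι (j, y))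
    exact hij (E.symm.injective (Subtype.ext (h₁.symm.trans h₂)))

theorem AffinePlane.exists_order_listGap {k : ℕ} (hk : 2 ≤ k) (M : ℕ) : ∃ N : ℕ, ∀ n : ℕ, N ≤ n →
    ∀ (P : Type) [Fintype P] (A : AffinePlane P), Fintype.card P = n ^ 2 →
    ∀ C₀ ∈ A.classes, ∀ C₁ ∈ A.classes, C₁ ≠ C₀ →
      (M : ℕ∞) ≤ (power (power (A.graph C₀ C₁ k) 4) k).chromaticNumber ∧
      ListGap (1 / 100) (power (power (A.graph C₀ C₁ k) 4) k) := by
  obtain ⟨N, hN⟩ := Filter.eventually_atTop.1 eventually_log_sq_lt_sqrt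
  refine ⟨max (max N M) (max 16 k), fun n hn P _ A hP C₀ hC₀ C₁ hC₁ hne => ?_⟩
  simp only [max_le_iff] at hn
  rw [power_power]
  have h := listGap_graph hP hC₀ hC₁ hne hk hn.2.1 hn.2.2 (hN n hn.1.1)
  exact ⟨le_trans (by exact_mod_cast hn.1.2) h.1, h.2⟩

theorem AffinePlane.exists_two_classes {P : Type} [Fintype P] (A : AffinePlane P)
    (hP : 1 < Fintype.card P) : ∃ C₀ ∈ A.classes, ∃ C₁ ∈ A.classes, C₁ ≠ C₀ := by
  obtain ⟨p, q, hpq⟩ := Fintype.exists_pair_of_one_lt_card hP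
  obtain ⟨l, ⟨hl, -⟩, -⟩ := A.join p q hpq
  obtain ⟨C₁, hC₁, hne, -⟩ := exists_third_class (classOf_mem hl) (A.classOf l)
  exact ⟨_, classOf_mem hl, C₁, hC₁, hne⟩

theorem exists_graph_listGap {k : ℕ} (hk : 1 ≤ k) (M : ℕ) :
    ∃ (V : Type) (_ : Finite V) (G : SimpleGraph V),
      (M : ℕ∞) ≤ (power G k).chromaticNumber ∧ ListGap (1 / 100) (power G k) := by
  have main : ∀ {k : ℕ}, 2 ≤ k → ∃ (V : Type) (_ : Finite V) (G : SimpleGraph V),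
      (M : ℕ∞) ≤ (power G k).chromaticNumber ∧ ListGap (1 / 100) (power G k) := by
    intro k hk
    obtain ⟨N, hN⟩ := AffinePlane.exists_order_listGap hk M
    obtain ⟨q, hqN, hq⟩ := Nat.exists_infinite_primes N
    obtain ⟨P, _, A, hP⟩ := AffinePlane.exists_affinePlane hq.isPrimePow
    obtain ⟨C₀, hC₀, C₁, hC₁, hne⟩ := A.exists_two_classes
      (hP ▸ Nat.one_lt_pow two_ne_zero hq.one_lt)
    exact ⟨_, AffinePlane.finite_vertex (C₁ := C₁) (by omega) hC₀, _,
      hN q hqN P A hP C₀ hC₀ C₁ hC₁ hne⟩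
  -- For exponent 1 the square of a graph found for exponent 2 is taken as the graph itself.
  obtain rfl | hk2 := hk.eq_or_lt
  · obtain ⟨V, hV, G, h⟩ := main le_rfl
    exact ⟨V, hV, power G 2, by rwa [power_one]⟩
  · exact main hk2

/-- Each new graph is chosen with a larger chromatic number of its `k`-th power than the previous
one. These numbers are isomorphism invariants, so the graphs are pairwise non-isomorphic, and the
numbers are unbounded. -/
theorem exists_family_listGap {c : ℝ} {k : ℕ} (h : ∀ M : ℕ, ∃ (V : Type) (_ : Finite V)
      (G : SimpleGraph V), (M : ℕ∞) ≤ (power G k).chromaticNumber ∧ ListGap c (power G k)) :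
    ∃ (V : ℕ → Type) (_ : ∀ i, Finite (V i)) (G : ∀ i, SimpleGraph (V i)),
      (∀ i j, i ≠ j → IsEmpty (G i ≃g G j)) ∧
      (∀ M : ℕ, ∃ i, (M : ℕ∞) ≤ (power (G i) k).chromaticNumber) ∧
      ∀ i, ListGap c (power (G i) k) := by
  choose V hV G hM hgap using h
  choose x y hx hy hxy using hgap
  let s : ℕ → ℕ := fun i => Nat.rec 0 (fun _ m => x m + 1) i
  have hmono : StrictMono fun i => x (s i) := by
    refine strictMono_nat_of_lt_succ fun i => ?_
    have := hM (s (i + 1))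
    rw [hx] at this
    have h' : s (i + 1) ≤ x (s (i + 1)) := by exact_mod_cast this
    exact h'
  refine ⟨fun i => V (s i), fun i => hV _, fun i => G (s i), fun i j hij => ⟨fun e => ?_⟩,
    fun M => ⟨M, ?_⟩, fun i => ⟨_, _, hx _, hy _, hxy _⟩⟩
  · have := SimpleGraph.chromaticNumber_congr (powerIso e k)
    rw [hx, hx] at this
    exact hij (hmono.injective (by exact_mod_cast this))
  · rw [hx]
    exact_mod_cast hmono.id_le M

theorem exists_not_chromaticChoosable {k : ℕ} (hk : 1 ≤ k) :
    ∃ (V : Type) (_ : Finite V) (G : SimpleGraph V),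
      listChromaticNumber (power G k) ≠ (power G k).chromaticNumber := by
  -- If $\chi\ge e^{200}$ then $\log\chi\ge 200$, and the constant $1/100$ yields $\chi_\ell\ge
  -- 2\chi$.
  obtain ⟨V, hV, G, hM, x, y, hx, hy, hxy⟩ := exists_graph_listGap hk ⌈Real.exp 200⌉₊
  refine ⟨V, hV, G, fun h => ?_⟩
  rw [hx] at hM h
  rw [hy] at h
  have hyx : y = x := by exact_mod_cast h
  have hMx : ⌈Real.exp 200⌉₊ ≤ x := by exact_mod_cast hM
  have hexp : Real.exp 200 ≤ x := Nat.ceil_le.1 hMx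
  have hx0 : (0 : ℝ) < x := (Real.exp_pos _).trans_le hexp
  have hlog : 200 ≤ Real.log x := (Real.le_log_iff_exp_le hx0).2 hexp
  rw [hyx] at hxy
  nlinarith

end PowerChoosability

theorem theorem1 :
    -- the constant `c`
    (∃ c : ℝ, 0 < c ∧
      -- for every `k` an infinite family of finite graphs with `χ(G^k)` unbounded
      (∀ k : ℕ, 1 ≤ k →
        ∃ (V : ℕ → Type) (_ : ∀ i, Finite (V i)) (G : ∀ i, SimpleGraph (V i)),
          (∀ i j, i ≠ j → IsEmpty (G i ≃g G j)) ∧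
          (∀ M : ℕ, ∃ i, (M : ℕ∞) ≤ (PowerChoosability.power (G i) k).chromaticNumber) ∧
          ∀ i, PowerChoosability.ListGap c (PowerChoosability.power (G i) k)) ∧
      -- for `k ≥ 2` the fourth powers of the constructed graphs of large order are such a family
      (∀ k : ℕ, 2 ≤ k → ∀ M : ℕ, ∃ N : ℕ, ∀ n : ℕ, N ≤ n →
        ∀ (P : Type) [Fintype P] (A : PowerChoosability.AffinePlane P), Fintype.card P = n ^ 2 →
        ∀ C₀ ∈ A.classes, ∀ C₁ ∈ A.classes, C₁ ≠ C₀ →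
          (M : ℕ∞) ≤ (PowerChoosability.power
            (PowerChoosability.power (A.graph C₀ C₁ k) 4) k).chromaticNumber ∧
          PowerChoosability.ListGap c (PowerChoosability.power
            (PowerChoosability.power (A.graph C₀ C₁ k) 4) k))) ∧
    -- for no `k` are all `k`-th powers chromatic-choosable
    (∀ k : ℕ, 1 ≤ k → ∃ (V : Type) (_ : Finite V) (G : SimpleGraph V),
      PowerChoosability.listChromaticNumber (PowerChoosability.power G k) ≠
        (PowerChoosability.power G k).chromaticNumber) ∧
    -- affine planes of every prime-power order exist
    (∀ q : ℕ, IsPrimePow q → ∃ (P : Type) (_ : Fintype P)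
      (_ : PowerChoosability.AffinePlane P), Fintype.card P = q ^ 2) ∧
    -- the structure of `G^{4k}`
    (∀ k : ℕ, 2 ≤ k → ∀ (n : ℕ) (P : Type) [Fintype P] (A : PowerChoosability.AffinePlane P),
      Fintype.card P = n ^ 2 →
      ∀ C₀ ∈ A.classes, ∀ C₁ ∈ A.classes, C₁ ≠ C₀ →
        -- the parts partition the vertices into `k n² + 1` sets of size `n`, independent in `G^{4k}`
        Setoid.IsPartition (A.parts C₀ C₁ k) ∧
        (A.parts C₀ C₁ k).ncard = k * n ^ 2 + 1 ∧
        (∀ S ∈ A.parts C₀ C₁ k, S.ncard = n) ∧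
        (∀ S ∈ A.parts C₀ C₁ k,
          (PowerChoosability.power (A.graph C₀ C₁ k) (4 * k)).IsIndepSet S) ∧
        -- levels `0, …, k - 1` consist of `(k - 1) n² + n` of the parts
        (A.lowParts C₀ C₁ k).ncard = (k - 1) * n ^ 2 + n ∧
        ⋃₀ (A.lowParts C₀ C₁ k) = {v | v.level < k} ∧
        -- and there any two vertices in different parts are adjacent in `G^{4k}`
        (∀ u v : PowerChoosability.AffinePlane.Vertex A C₀ C₁ k, u.level < k → v.level < k →
          ((PowerChoosability.power (A.graph C₀ C₁ k) (4 * k)).Adj u v ↔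
            ∀ S ∈ A.lowParts C₀ C₁ k, u ∈ S → v ∉ S))) := by
  refine ⟨⟨1 / 100, by norm_num, fun k hk => PowerChoosability.exists_family_listGap
    (PowerChoosability.exists_graph_listGap hk),
    fun k hk M => PowerChoosability.AffinePlane.exists_order_listGap hk M⟩,
    fun k hk => PowerChoosability.exists_not_chromaticChoosable hk,
    fun q hq => PowerChoosability.AffinePlane.exists_affinePlane hq, ?_⟩
  intro k hk n P _ A hP C₀ hC₀ C₁ hC₁ hne
  have hk1 : 1 ≤ k := by omega
  exact ⟨PowerChoosability.AffinePlane.isPartition_parts hk1 hC₀ hC₁ hne,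
    PowerChoosability.AffinePlane.ncard_parts hP hk1 hC₀ hC₁ hne,
    fun S hS => PowerChoosability.AffinePlane.ncard_of_mem_parts hP hk1 hC₀ hS,
    fun S hS => PowerChoosability.AffinePlane.isIndepSet_part hk1 hC₀ hC₁ hS,
    PowerChoosability.AffinePlane.ncard_lowParts hP hk1 hC₀ hC₁ hne,
    PowerChoosability.AffinePlane.sUnion_lowParts hk1 hC₀ hC₁ hne,
    fun u v hu hv => PowerChoosability.AffinePlane.adj_power_iff hk1 hC₀ hC₁ hne hu hv⟩
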